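/- Let $\delta>0$, let $D\subset\mathbb R^2$ be a bounded open set and let $\Omega\subset\mathbb R^3$ be an open set with $$D\times(0,\delta)\subset\Omega\subset (D+B_\delta)\times(0,\delta),\qquad D+B_\delta=\{r\in\mathbb R^2:\operatorname{dist}(r,D)<\delta\}$$ (no regularity of the boundaries is required, and $D$ need not be connected). Let $\eta\in C^\infty(\mathbb R;[0,1])$ satisfy $\eta(t)=0$ for $t\le 1$, $\eta(t)=1$ for $t\ge 2$ and $0\le\eta'\le 2$, and put $\chi_\delta(r)=\eta(\delta^{-1}\operatorname{dist}(r,\mathbb R^2\setminus D))$ for $r\in\mathbb R^2$, regarded also as a $z$-independent function on $\mathbb R^3$. Let $\phi\in H^1(\Omega)$ be real-valued and extended by zero to $\mathbb R^3$, and let $\bar\phi(x,y)=\frac1\delta\int_0^\delta\phi(x,y,z)\,dz$ for $(x,y)\in D$, extended by zero to $\mathbb R^2$. Then: the distributional derivative $\partial_z(\chi_\delta\phi)$ in $\mathbb R^3$ is a finite signed measure, for which the double integral $$\int_{\mathbb R^3}\partial_z(\chi_\delta\phi)(-\Delta)^{-1}\partial_z(\chi_\delta\phi)\,d^3r:=\frac1{4\pi}\int_{\mathbb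 R^3}\int_{\mathbb R^3}\frac{\partial_z(\chi_\delta\phi)(\mathbf r)\,\partial_z(\chi_\delta\phi)(\mathbf r')}{|\mathbf r-\mathbf r'|}\,d^3r\,d^3r'$$ converges absolutely; $(-\Delta)^{1/2}(\chi_\delta\bar\phi)$, defined through the Fourier symbol $|k|$, belongs to $L^2(\mathbb R^2)$; $\chi_\delta\phi$ has a weak gradient in $L^2(\Omega)$; and $$\left|\int_{\mathbb R^3}\Big(\partial_z(\chi_\delta\phi)(-\Delta)^{-1}\partial_z(\chi_\delta\phi)-\chi_\delta^2\phi^2\Big)d^3r+\frac{\delta^2}{2}\int_{\mathbb R^2}\chi_\delta\bar\phi\,(-\Delta)^{1/2}(\chi_\delta\bar\phi)\,d^2r\right|\le\frac{\delta^2}{2}\int_\Omega|\nabla(\chi_\delta\phi)|^2\,d^3r .$$ -/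

import Mathlib

open MeasureTheory
open scoped FourierTransform ENNReal

namespace ThinFilm

noncomputable section

/-- The plane `ℝ²`, with its Euclidean norm. -/
abbrev E2 : Type := EuclideanSpace ℝ (Fin 2)

/-- The space `ℝ³`, with its Euclidean norm; the coordinates `0, 1, 2` are `x, y, z`. -/
abbrev E3 : Type := EuclideanSpace ℝ (Fin 3)

/-- The in-plane part `(x, y)` of a point `(x, y, z)`. -/
def planar (p : E3) : E2 := !₂[p 0, p 1]

/-- The point `(x, y, z)` over the point `r = (x, y)` of the plane, at height `z`. -/
def atHeight (r : E2) (z : ℝ) : E3 := !₂[r 0, r 1, z]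

/-- `Ω` is a film of thickness `δ` and bounded cross-section `D`:
`D × (0, δ) ⊆ Ω ⊆ (D + B_δ) × (0, δ)`. -/
structure IsFilm (δ : ℝ) (D : Set E2) (Ω : Set E3) : Prop where
  isOpen_section : IsOpen D
  isBounded_section : Bornology.IsBounded D
  isOpen_film : IsOpen Ω
  subset_film : {p : E3 | planar p ∈ D ∧ p 2 ∈ Set.Ioo 0 δ} ⊆ Ω
  film_subset : Ω ⊆ {p : E3 | planar p ∈ Metric.thickening δ D ∧ p 2 ∈ Set.Ioo 0 δ}

/-- The profiles from which the cutoff near the edge of the film is made. -/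
structure IsCutoffProfile (η : ℝ → ℝ) : Prop where
  smooth : ContDiff ℝ (⊤ : ℕ∞) η
  mem_unit : ∀ t, η t ∈ Set.Icc (0 : ℝ) 1
  eq_zero : ∀ t, t ≤ 1 → η t = 0
  eq_one : ∀ t, 2 ≤ t → η t = 1
  deriv_mem : ∀ t, deriv η t ∈ Set.Icc (0 : ℝ) 2

/-- The cutoff `χ_δ(r) = η(δ⁻¹ dist(r, ℝ² \ D))` in the plane. -/
def cutoff (η : ℝ → ℝ) (δ : ℝ) (D : Set E2) (r : E2) : ℝ :=
  η (δ⁻¹ * Metric.infDist r Dᶜ)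

/-- Smooth functions on `ℝ³` with compact support inside `U`. -/
def IsTestFunction (U : Set E3) (ζ : E3 → ℝ) : Prop :=
  ContDiff ℝ (⊤ : ℕ∞) ζ ∧ HasCompactSupport ζ ∧ tsupport ζ ⊆ U

/-- The partial derivative `∂_i ζ`. -/
def partialDeriv (i : Fin 3) (ζ : E3 → ℝ) (p : E3) : ℝ :=
  fderiv ℝ ζ p (EuclideanSpace.single i 1)

/-- `G` is the weak gradient of `u` in the open set `Ω`. -/
def IsWeakGradient (Ω : Set E3) (u : E3 → ℝ) (G : E3 → E3) : Prop :=
  LocallyIntegrableOn u Ω volume ∧ LocallyIntegrableOn G Ω volume ∧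
    ∀ ζ : E3 → ℝ, IsTestFunction Ω ζ → ∀ i : Fin 3,
      ∫ p in Ω, u p * partialDeriv i ζ p = - ∫ p in Ω, G p i * ζ p

/-- `u ∈ H¹(Ω)`. -/
def MemH1 (Ω : Set E3) (u : E3 → ℝ) : Prop :=
  MemLp u 2 (volume.restrict Ω) ∧
    ∃ G : E3 → E3, IsWeakGradient Ω u G ∧ MemLp G 2 (volume.restrict Ω)

/-- The function `χ_δ φ` on `ℝ³`, where `φ` is extended by zero outside `Ω` and `χ_δ` does not
depend on `z`. -/
def cutField (η : ℝ → ℝ) (δ : ℝ) (D : Set E2) (Ω : Set E3) (φ : E3 → ℝ) (p : E3) : ℝ :=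
  cutoff η δ D (planar p) * Ω.indicator φ p

/-- The average `φ̄(x, y) = δ⁻¹ ∫₀^δ φ(x, y, z) dz` for `(x, y) ∈ D`, extended by zero to the
rest of the plane. -/
def zAverage (δ : ℝ) (D : Set E2) (φ : E3 → ℝ) : E2 → ℝ :=
  D.indicator fun r => δ⁻¹ * ∫ z in (0 : ℝ)..δ, φ (atHeight r z)

/-- The function `χ_δ φ̄` on the plane. -/
def cutAverage (η : ℝ → ℝ) (δ : ℝ) (D : Set E2) (φ : E3 → ℝ) (r : E2) : ℝ :=
  cutoff η δ D r * zAverage δ D φ r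

/-- The distributional derivative `∂_z u` in the whole of `ℝ³` is the finite signed measure
`μ - ν`. -/
def IsDistribDerivZ (u : E3 → ℝ) (μ ν : Measure E3) : Prop :=
  LocallyIntegrable u volume ∧ IsFiniteMeasure μ ∧ IsFiniteMeasure ν ∧
    ∀ ζ : E3 → ℝ, IsTestFunction Set.univ ζ →
      ∫ p, u p * partialDeriv 2 ζ p = - (∫ p, ζ p ∂μ - ∫ p, ζ p ∂ν)

/-- The mutual Newtonian energy `∬ dμ(p) dν(q) / (4π |p - q|)` of two positive measures,
with value `∞` for the kernel on the diagonal. -/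
def newtonEnergy (μ ν : Measure E3) : ℝ≥0∞ :=
  ENNReal.ofReal (1 / (4 * Real.pi)) * ∫⁻ p, ∫⁻ q, (edist p q)⁻¹ ∂ν ∂μ

/-- `E = ∫ ∂_z u (-Δ)⁻¹ ∂_z u = (1 / 4π) ∬ ∂_z u(p) ∂_z u(q) / |p - q|`, where the distributional
derivative `∂_z u = μ - ν` is a finite signed measure and the double integral converges
absolutely. Then `E` does not depend on how that measure is written as a difference. -/
def HasDipolarEnergy (u : E3 → ℝ) (E : ℝ) : Prop :=
  ∃ μ ν : Measure E3, IsDistribDerivZ u μ ν ∧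
    newtonEnergy (μ + ν) (μ + ν) ≠ ∞ ∧
    E = (newtonEnergy μ μ).toReal - (newtonEnergy μ ν).toReal
      - (newtonEnergy ν μ).toReal + (newtonEnergy ν ν).toReal

/-- `g = (-Δ)^{1/2} u` in `L²(ℝ²)`, the operator with Fourier symbol `|k|`. The Fourier
transform on `L²` is normalized with the kernel `exp(-2πi ⟨r, ξ⟩)`, so `|k| = 2π |ξ|`. -/
def IsHalfLaplacian (u g : E2 → ℝ) : Prop :=
  ∃ (hu : MemLp (fun r => (u r : ℂ)) 2 (volume : Measure E2))
    (hg : MemLp (fun r => (g r : ℂ)) 2 (volume : Measure E2)),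
    (𝓕 (hg.toLp (fun r => (g r : ℂ))) : Lp (α := E2) ℂ 2 volume) =ᵐ[volume]
      fun ξ => ((2 * Real.pi * ‖ξ‖ : ℝ) : ℂ) *
        (𝓕 (hu.toLp (fun r => (u r : ℂ))) : Lp (α := E2) ℂ 2 volume) ξ

end

end ThinFilm

open ThinFilm

/-!
The proof passes to Fourier space. Write `u = χ_δ φ`, write `k` and `s` for the in-plane and the
vertical frequency, and let `û` be the Fourier transform of `u`.

* The Newtonian kernel has symbol `1 / (4π² |ξ|²)`, so the dipolar energy is `∫ |û|² s² / |ξ|²`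
  (`signed_newtonEnergy_eq_fourier`; the kernel is written as a superposition of Gaussians, for
  which everything converges). As `s² / |ξ|² = 1 - |k|² / (|k|² + s²)`, subtracting `∫ u² = ∫ |û|²`
  leaves `-∫ |û|² |k|² / (|k|² + s²)`.
* For fixed `k`, the function `s ↦ |k|² / (|k|² + s²)` is the transform of the Poisson kernel
  `K(z) = π |k| exp(-2π |k| |z|)`. Replacing `K(z - z')` by `K(0) = π |k|` turns the integral over
  `s` into `π |k| |û(k, 0)|²`, where `û(k, 0)` is the transform of `δ χ_δ φ̄`; this is the
  half-Laplacian term. Since `0 ≤ K(0) - K(z) ≤ 2π² |k|² |z|` and `|z - z'| ≤ δ` in the film, the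
  Cauchy-Schwarz inequality bounds the error by `2π² δ² |k|² ∫ |û(k, s)|² ds`
  (`abs_poisson_sub_mean_le`). Integration over `k` gives `δ² / 2` times the square of the `L²` norm
  of the in-plane gradient of `u` (`film_fourier_estimate`).

It remains to connect these formulas with weak derivatives of a function on an open set without
boundary regularity. The cutoff `χ_δ` vanishes near the lateral boundary and is merely Lipschitz;
`integral_cutField_mul_partialDeriv` mollifies it, and thereby allows every smooth `ζ` as a test
function for the in-plane derivatives, and every smooth `ζ` that vanishes on `z = 0` and `z = δ` for
the vertical one. A general `ζ` differs from such a function by its linear interpolation between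
bottom and top, and no trace of `u` is needed: the vertical derivative of `u` is the volume charge
`f = ∂_z u` in the film, together with explicit integrable densities `a` and `b` that are moved
vertically to the bottom and to the top (`integral_mul_partialDeriv_two`). Seen from above, these
charges have square integrable densities on a bounded part of the slab, and `1 / |r - r'|` is
locally integrable in the plane, so that the double integral converges absolutely
(`newtonEnergy_ne_top`).
-/

namespace ThinFilm

/-! ### Plancherel's theorem on `L¹ ∩ L²` -/

section Plancherel

variable {V : Type*} [NormedAddCommGroup V] [InnerProductSpace ℝ V] [FiniteDimensional ℝ V]
  [MeasurableSpace V] [BorelSpace V]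

open scoped ComplexConjugate

lemma continuous_fourier {f : V → ℂ} (hf : Integrable f) : Continuous (𝓕 f) := by
  have hL : Continuous fun p : V × V ↦ innerₗ V p.1 p.2 := continuous_inner
  exact VectorFourier.fourierIntegral_continuous Real.continuous_fourierChar hL hf

/-- On `L¹ ∩ L²` the Fourier transform of `L²` is given by the Fourier integral. -/
lemma fourier_toLp_ae {f : V → ℂ} (hf : Integrable f) (hf2 : MemLp f 2) :
    (𝓕 (hf2.toLp f) : Lp (α := V) ℂ 2 volume) =ᵐ[volume] 𝓕 f := by
  have hL : Continuous fun p : V × V ↦ innerₗ V p.1 p.2 := continuous_inner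
  refine ae_eq_of_integral_contDiff_smul_eq
    ((Lp.memLp (𝓕 (hf2.toLp f) : Lp (α := V) ℂ 2 volume)).locallyIntegrable (by norm_num))
    (continuous_fourier hf).locallyIntegrable fun g hg hgc => ?_
  have hg₁ : HasCompactSupport (Complex.ofRealCLM ∘ g) := hgc.comp_left rfl
  have hg₂ : ContDiff ℝ (⊤ : ℕ∞) (Complex.ofRealCLM ∘ g) := Complex.ofRealCLM.contDiff.comp hg
  set G : SchwartzMap V ℂ := hg₁.toSchwartzMap hg₂ with hG
  have hGg : ∀ x, G x = (g x : ℂ) := fun x => by simp [hG]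
  have key := congrArg (fun T : TemperedDistribution V ℂ => T G)
    (Lp.fourier_toTemperedDistribution_eq (hf2.toLp f))
  simp only [TemperedDistribution.fourier_apply, Lp.toTemperedDistribution_apply,
    smul_eq_mul, hGg] at key
  have e1 : ∫ x, g x • (𝓕 (hf2.toLp f) : Lp (α := V) ℂ 2 volume) x
      = ∫ x, (𝓕 G) x * (hf2.toLp f) x := by
    simpa [Complex.real_smul] using key.symm
  rw [e1]
  have e2 := VectorFourier.integral_fourierIntegral_smul_eq_flip (L := innerₗ V) (μ := volume)
    (ν := volume) Real.continuous_fourierChar hL hf G.integrable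
  calc ∫ x, (𝓕 G) x * (hf2.toLp f) x = ∫ x, f x • (𝓕 (G : V → ℂ)) x := by
        refine integral_congr_ae ?_
        filter_upwards [hf2.coeFn_toLp] with x hx
        rw [hx, SchwartzMap.fourier_coe, smul_eq_mul, mul_comm]
    _ = ∫ x, 𝓕 f x • G x := by
        rw [flip_innerₗ V] at e2
        exact e2.symm
    _ = ∫ x, g x • 𝓕 f x := by
        simp [hGg, Complex.real_smul, mul_comm]

/-- Parseval's identity for a function in `L¹ ∩ L²` and an element of `L²`. -/
lemma parseval {f : V → ℂ} (hf : Integrable f) (hf2 : MemLp f 2) (H : Lp (α := V) ℂ 2 volume) :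
    ∫ x, conj (f x) * H x = ∫ ξ, conj (𝓕 f ξ) * (𝓕 H : Lp (α := V) ℂ 2 volume) ξ := by
  have h := Lp.inner_fourier_eq (hf2.toLp f) H
  rw [L2.inner_def, L2.inner_def] at h
  rw [← integral_congr_ae (f := fun a => inner ℂ ((hf2.toLp f) a) (H a)), ← h]
  · refine integral_congr_ae ?_
    filter_upwards [fourier_toLp_ae hf hf2] with x hx
    rw [hx, RCLike.inner_apply, mul_comm]
  · filter_upwards [hf2.coeFn_toLp] with x hx
    rw [hx, RCLike.inner_apply, mul_comm]

lemma memLp_fourier {f : V → ℂ} (hf : Integrable f) (hf2 : MemLp f 2) : MemLp (𝓕 f) 2 :=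
  (memLp_congr_ae (fourier_toLp_ae hf hf2)).1 (Lp.memLp _)

/-- Parseval's identity on `L¹ ∩ L²`. -/
lemma parseval_of_integrable {f g : V → ℂ} (hf : Integrable f) (hf2 : MemLp f 2) (hg : Integrable g)
    (hg2 : MemLp g 2) : ∫ x, conj (f x) * g x = ∫ ξ, conj (𝓕 f ξ) * 𝓕 g ξ := by
  rw [← integral_congr_ae (f := fun x => conj (f x) * (hg2.toLp g) x), parseval hf hf2]
  · refine integral_congr_ae ?_
    filter_upwards [fourier_toLp_ae hg hg2] with x hx
    rw [hx]
  · filter_upwards [hg2.coeFn_toLp] with x hx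
    rw [hx]

lemma plancherel {f : V → ℂ} (hf : Integrable f) (hf2 : MemLp f 2) :
    ∫ ξ, ‖𝓕 f ξ‖ ^ 2 = ∫ x, ‖f x‖ ^ 2 := by
  have h := parseval_of_integrable hf hf2 hf hf2
  simp only [Complex.conj_mul'] at h
  have : ((∫ x, ‖f x‖ ^ 2 : ℝ) : ℂ) = ((∫ ξ, ‖𝓕 f ξ‖ ^ 2 : ℝ) : ℂ) := by
    rw [← integral_complex_ofReal, ← integral_complex_ofReal]
    simpa using h
  exact_mod_cast this.symm

lemma fourier_neg_ofReal (f : V → ℝ) (ξ : V) :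
    𝓕 (fun x => (f x : ℂ)) (-ξ) = conj (𝓕 (fun x => (f x : ℂ)) ξ) := by
  simp only [Real.fourier_eq']
  rw [← integral_conj]
  refine integral_congr_ae (Filter.Eventually.of_forall fun x => ?_)
  simp only [smul_eq_mul, map_mul, Complex.conj_ofReal, ← Complex.exp_conj]
  congr 2
  simp

/-- An element of `L²` whose Fourier transform is Hermitian is real-valued. -/
lemma im_eq_zero_of_fourier_hermitian (H : Lp (α := V) ℂ 2 volume) {h : V → ℂ}
    (hH : (𝓕 H : Lp (α := V) ℂ 2 volume) =ᵐ[volume] h) (hh : ∀ ξ, h (-ξ) = conj (h ξ)) :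
    ∀ᵐ x, (H x).im = 0 := by
  have hloc : LocallyIntegrable H volume := (Lp.memLp H).locallyIntegrable (by norm_num)
  refine ae_eq_zero_of_integral_contDiff_smul_eq_zero (μ := volume) (f := fun x => (H x).im) ?_ ?_
  · intro x
    obtain ⟨s, hs, hi⟩ := hloc x
    exact ⟨s, hs, hi.im⟩
  intro g hg hgc
  have hgi : Integrable (fun x => (g x : ℂ)) := (hg.continuous.integrable_of_hasCompactSupport hgc).ofReal
  have hg2 : MemLp (fun x => (g x : ℂ)) 2 := by
    refine Continuous.memLp_of_hasCompactSupport (by fun_prop) ?_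
    exact hgc.comp_left (g := Complex.ofReal) rfl
  have key := parseval hgi hg2 H
  have hI : Integrable (fun x => (g x : ℂ) * H x) := by
    have := hloc.integrable_smul_left_of_hasCompactSupport hg.continuous hgc
    simpa [Complex.real_smul] using this
  have e1 : ∫ x, g x • (H x).im = (∫ x, conj (g x : ℂ) * H x).im := by
    simp only [Complex.conj_ofReal]
    have := integral_im hI
    simp only [RCLike.im_to_complex, Complex.im_ofReal_mul] at this
    simpa using this
  rw [e1, key]
  set J := ∫ ξ, conj (𝓕 (fun x => (g x : ℂ)) ξ) * (𝓕 H : Lp (α := V) ℂ 2 volume) ξ with hJ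
  have hJ' : J = ∫ ξ, conj (𝓕 (fun x => (g x : ℂ)) ξ) * h ξ := by
    refine integral_congr_ae ?_
    filter_upwards [hH] with x hx
    rw [hx]
  -- The substitution `ξ ↦ -ξ` conjugates the integrand.
  have : conj J = J := by
    rw [hJ', ← integral_conj, ← integral_neg_eq_self]
    refine integral_congr_ae (Filter.Eventually.of_forall fun x => ?_)
    simp only [fourier_neg_ofReal, hh, map_mul, Complex.conj_conj]
  exact Complex.conj_eq_iff_im.1 this

end Plancherel

/-! ### The half-Laplacian -/

section HalfLaplacian

open scoped ComplexConjugate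

/-- If `|k| ŵ` is square integrable, then `(-Δ)^{1/2} w` exists as a real function, and its pairing
with `w` is the quadratic form `∫ |k| |ŵ|²`. -/
lemma exists_halfLaplacian {w : E2 → ℝ} (hw : Integrable w) (hw2 : MemLp w 2)
    (hh : MemLp (fun ξ => ((2 * Real.pi * ‖ξ‖ : ℝ) : ℂ) * 𝓕 (fun r => (w r : ℂ)) ξ) 2) :
    ∃ g : E2 → ℝ, IsHalfLaplacian w g ∧
      ∫ r, w r * g r = ∫ ξ, 2 * Real.pi * ‖ξ‖ * ‖𝓕 (fun r => (w r : ℂ)) ξ‖ ^ 2 := by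
  have hwi : Integrable (fun r => (w r : ℂ)) := hw.ofReal
  have hwc : MemLp (fun r => (w r : ℂ)) 2 := hw2.ofReal
  set W := 𝓕 (fun r => (w r : ℂ)) with hW
  set h : E2 → ℂ := fun ξ => ((2 * Real.pi * ‖ξ‖ : ℝ) : ℂ) * W ξ with hhdef
  set H : Lp (α := E2) ℂ 2 volume := 𝓕⁻ (hh.toLp h) with hHdef
  have hFH : (𝓕 H : Lp (α := E2) ℂ 2 volume) =ᵐ[volume] h := by
    rw [hHdef, FourierTransform.fourier_fourierInv_eq]
    exact hh.coeFn_toLp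
  have him := im_eq_zero_of_fourier_hermitian H hFH (fun ξ => by
    simp only [hhdef, hW, fourier_neg_ofReal, norm_neg, map_mul, Complex.conj_ofReal])
  have hre : H =ᵐ[volume] fun r => (((H r).re : ℝ) : ℂ) := by
    filter_upwards [him] with r hr
    apply Complex.ext <;> simp [hr]
  have hg : MemLp (fun r => (((H r).re : ℝ) : ℂ)) 2 (volume : Measure E2) :=
    (memLp_congr_ae hre).1 (Lp.memLp H)
  have hgH : hg.toLp _ = H := by
    apply Lp.ext
    exact hg.coeFn_toLp.trans hre.symm
  refine ⟨fun r => (H r).re, ⟨hwc, hg, ?_⟩, ?_⟩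
  · rw [hgH]
    filter_upwards [hFH, fourier_toLp_ae hwi hwc] with ξ h1 h2
    rw [h1, h2]
  · have key := parseval hwi hwc H
    have e1 : ∫ r, conj (w r : ℂ) * H r = ((∫ r, w r * (H r).re : ℝ) : ℂ) := by
      rw [← integral_complex_ofReal]
      refine integral_congr_ae ?_
      filter_upwards [hre] with r hr
      rw [hr]
      simp
    have e2 : ∫ ξ, conj (W ξ) * (𝓕 H : Lp (α := E2) ℂ 2 volume) ξ
        = ((∫ ξ, 2 * Real.pi * ‖ξ‖ * ‖W ξ‖ ^ 2 : ℝ) : ℂ) := by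
      rw [← integral_complex_ofReal]
      refine integral_congr_ae ?_
      filter_upwards [hFH] with ξ hξ
      rw [hξ]
      simp only [hhdef, Complex.ofReal_mul, Complex.ofReal_pow]
      rw [← Complex.conj_mul']
      ring
    rw [e1, e2] at key
    exact_mod_cast key

end HalfLaplacian

/-! ### The Poisson kernel on an interval -/

section OneDim

open scoped ComplexConjugate

lemma integrable_exp_neg_abs {b : ℝ} (hb : 0 < b) :
    Integrable (fun x : ℝ => Real.exp (-(b * |x|))) := by
  have h₁ : IntegrableOn (fun x : ℝ => Real.exp (-(b * |x|))) (Set.Iic 0) :=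
    (integrableOn_congr_fun (fun x hx => by
      rw [abs_of_nonpos hx]; ring_nf) measurableSet_Iic).1 (integrableOn_exp_mul_Iic hb 0)
  have h₂ : IntegrableOn (fun x : ℝ => Real.exp (-(b * |x|))) (Set.Ioi 0) :=
    (integrableOn_congr_fun (fun x hx => by
      rw [abs_of_pos hx, neg_mul]) measurableSet_Ioi).1
      (integrableOn_exp_mul_Ioi (a := -b) (by linarith) 0)
  rw [← integrableOn_univ, ← Set.Iic_union_Ioi (a := (0 : ℝ))]
  exact h₁.union h₂

lemma memLp_two_of_bounded {α E : Type*} [MeasurableSpace α] [NormedAddCommGroup E]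
    {μ : Measure α} {f : α → E} {C : ℝ} (hf : Integrable f μ) (hC : ∀ x, ‖f x‖ ≤ C) :
    MemLp f 2 μ := by
  rw [memLp_two_iff_integrable_sq_norm hf.1]
  refine (hf.norm.const_mul C).mono' (by have := hf.1; fun_prop)
    (Filter.Eventually.of_forall fun x => ?_)
  rw [norm_pow, norm_norm, sq]
  gcongr
  exact hC x

/-- The Cauchy-Schwarz inequality `‖v‖₁² ≤ |S| ‖v‖₂²` for `v` supported in `S`. -/
lemma sq_integral_norm_le {α E : Type*} [MeasurableSpace α] [NormedAddCommGroup E]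
    {μ : Measure α} {S : Set α} (hS : μ S ≠ ∞) {v : α → E} (hv : Integrable v μ)
    (hv2 : MemLp v 2 μ) (hsupp : ∀ z, z ∉ S → v z = 0) :
    (∫ z, ‖v z‖ ∂μ) ^ 2 ≤ μ.real S * ∫ z, ‖v z‖ ^ 2 ∂μ := by
  set N := ∫ z, ‖v z‖ ∂μ with hN
  have hi2 : Integrable (fun z => ‖v z‖ ^ 2) μ := (memLp_two_iff_integrable_sq_norm hv.1).1 hv2
  have e1 : N = ∫ z in S, ‖v z‖ ∂μ :=
    (setIntegral_eq_integral_of_forall_compl_eq_zero fun z hz => by simp [hsupp z hz]).symm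
  have e2 : ∫ z, ‖v z‖ ^ 2 ∂μ = ∫ z in S, ‖v z‖ ^ 2 ∂μ :=
    (setIntegral_eq_integral_of_forall_compl_eq_zero fun z hz => by simp [hsupp z hz]).symm
  rcases (measureReal_nonneg (μ := μ) (s := S)).eq_or_lt with h0 | hδ
  · have : μ S = 0 := by
      simpa [Measure.real, ENNReal.toReal_eq_zero_iff, hS] using h0.symm
    rw [e1, Measure.restrict_eq_zero.2 this, ← h0]
    simp
  set δ := μ.real S with hδdef
  -- Expanding this square gives the inequality.
  have h0 : 0 ≤ ∫ z in S, (δ * ‖v z‖ - N) ^ 2 ∂μ := integral_nonneg fun _ => sq_nonneg _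
  have e3 : ∫ z in S, (δ * ‖v z‖ - N) ^ 2 ∂μ
      = δ ^ 2 * (∫ z, ‖v z‖ ^ 2 ∂μ) - 2 * δ * N * N + δ * N ^ 2 := by
    have : ∀ z, (δ * ‖v z‖ - N) ^ 2 = δ ^ 2 * ‖v z‖ ^ 2 - 2 * δ * N * ‖v z‖ + N ^ 2 :=
      fun z => by ring
    simp only [this]
    have hc : IntegrableOn (fun _ : α => N ^ 2) S μ := integrableOn_const hS
    have hd : IntegrableOn (fun z => δ ^ 2 * ‖v z‖ ^ 2 - 2 * δ * N * ‖v z‖) S μ :=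
      (hi2.integrableOn.const_mul _).sub (hv.norm.integrableOn.const_mul _)
    rw [integral_add hd hc, integral_sub (hi2.integrableOn.const_mul _)
      (hv.norm.integrableOn.const_mul _), integral_const_mul, integral_const_mul, ← e1, ← e2]
    simp [hδdef]
  rw [e3] at h0
  have : 0 ≤ δ * (δ * (∫ z, ‖v z‖ ^ 2 ∂μ) - N ^ 2) := by nlinarith
  have := nonneg_of_mul_nonneg_right this hδ
  linarith

/-- The Fourier transform of the Poisson kernel `π a exp(-2π a |x|)`. -/
lemma fourier_exp_neg_abs {a : ℝ} (ha : 0 < a) (s : ℝ) :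
    𝓕 (fun x : ℝ => ((Real.pi * a * Real.exp (-(2 * Real.pi * a * |x|)) : ℝ) : ℂ)) s
      = ((a ^ 2 / (a ^ 2 + s ^ 2) : ℝ) : ℂ) := by
  have hpi := Real.pi_pos
  rw [Real.fourier_real_eq_integral_exp_smul]
  set c₁ : ℂ := 2 * Real.pi * (a - s * Complex.I) with hc₁
  set c₂ : ℂ := -(2 * Real.pi * (a + s * Complex.I)) with hc₂
  have h₁ : 0 < c₁.re := by simp [hc₁]; positivity
  have h₂ : c₂.re < 0 := by simp [hc₂]; positivity
  have e₁ : ∀ x ∈ Set.Iic (0 : ℝ), Complex.exp (↑(-2 * Real.pi * x * s) * Complex.I) •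
      ((Real.pi * a * Real.exp (-(2 * Real.pi * a * |x|)) : ℝ) : ℂ)
      = Real.pi * a * Complex.exp (c₁ * x) := by
    intro x hx
    rw [abs_of_nonpos hx]
    push_cast
    rw [smul_eq_mul, mul_left_comm, ← Complex.exp_add]
    congr 2
    rw [hc₁]; ring
  have e₂ : ∀ x ∈ Set.Ioi (0 : ℝ), Complex.exp (↑(-2 * Real.pi * x * s) * Complex.I) •
      ((Real.pi * a * Real.exp (-(2 * Real.pi * a * |x|)) : ℝ) : ℂ)
      = Real.pi * a * Complex.exp (c₂ * x) := by
    intro x hx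
    rw [abs_of_pos hx]
    push_cast
    rw [smul_eq_mul, mul_left_comm, ← Complex.exp_add]
    congr 2
    rw [hc₂]; ring
  have i₁ := (integrableOn_exp_mul_complex_Iic h₁ 0).const_mul ((Real.pi : ℂ) * a)
  have i₂ := (integrableOn_exp_mul_complex_Ioi h₂ 0).const_mul ((Real.pi : ℂ) * a)
  rw [← intervalIntegral.integral_Iic_add_Ioi (b := 0)
    ((integrableOn_congr_fun e₁ measurableSet_Iic).2 i₁)
    ((integrableOn_congr_fun e₂ measurableSet_Ioi).2 i₂),
    setIntegral_congr_fun measurableSet_Iic e₁, setIntegral_congr_fun measurableSet_Ioi e₂,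
    integral_const_mul, integral_const_mul, integral_exp_mul_complex_Iic h₁,
    integral_exp_mul_complex_Ioi h₂]
  have n₁ : (a : ℂ) - s * Complex.I ≠ 0 := by
    intro h; rw [hc₁, h] at h₁; simp at h₁
  have n₂ : (a : ℂ) + s * Complex.I ≠ 0 := by
    intro h; rw [hc₂, h] at h₂; simp at h₂
  have hp : (Real.pi : ℂ) ≠ 0 := by exact_mod_cast hpi.ne'
  have hprod : (a : ℂ) ^ 2 + s ^ 2 = (a - s * Complex.I) * (a + s * Complex.I) := by
    ring_nf; rw [Complex.I_sq]; ring
  push_cast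
  rw [hprod, hc₁, hc₂]
  simp only [mul_zero, Complex.exp_zero]
  field_simp
  ring

/-- The estimate of the film problem at one in-plane frequency `a`. Convolution with the Poisson
kernel `K(x) = π a exp(-2π a |x|)` turns the left-hand side into
`∬ (K(0) - K(z - z')) conj v(z) v(z')`, where `0 ≤ K(0) - K(x) ≤ 2π² a² |x|`. -/
lemma abs_poisson_sub_mean_le {δ a : ℝ} (hδ : 0 < δ) (ha : 0 ≤ a) {v : ℝ → ℂ}
    (hv : Integrable v) (hv2 : MemLp v 2) (hsupp : ∀ z, z ∉ Set.Ioo 0 δ → v z = 0) :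
    |Real.pi * a * ‖𝓕 v 0‖ ^ 2 - ∫ s, ‖𝓕 v s‖ ^ 2 * (a ^ 2 / (a ^ 2 + s ^ 2))|
      ≤ 2 * Real.pi ^ 2 * a ^ 2 * δ ^ 2 * ∫ s, ‖𝓕 v s‖ ^ 2 := by
  have hpi := Real.pi_pos
  rcases ha.eq_or_lt with rfl | ha
  · simp
  set K : ℝ → ℝ := fun x => Real.pi * a * Real.exp (-(2 * Real.pi * a * |x|)) with hK
  set Kc : ℝ → ℂ := fun x => (K x : ℂ) with hKc
  have hKi : Integrable K := (integrable_exp_neg_abs (by positivity)).const_mul _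
  have hKci : Integrable Kc := hKi.ofReal
  have hKcont : Continuous Kc := by simp only [hKc, hK]; fun_prop
  have hKb : ∀ x, ‖Kc x‖ ≤ Real.pi * a := by
    intro x
    rw [hKc, Complex.norm_real, Real.norm_of_nonneg (by positivity)]
    refine mul_le_of_le_one_right (by positivity) (Real.exp_le_one_iff.2 ?_)
    have : 0 ≤ 2 * Real.pi * a * |x| := by positivity
    linarith
  set Kv : ℝ → ℂ := convolution Kc v (ContinuousLinearMap.mul ℂ ℂ) with hKv
  have hKvi : Integrable Kv := hKci.integrable_convolution _ hv
  have hKv_eq : ∀ z, Kv z = ∫ z', Kc (z - z') * v z' := by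
    intro z
    rw [hKv, convolution_eq_swap]
    rfl
  have hint : ∀ z, Integrable (fun z' => Kc (z - z') * v z') := fun z =>
    hv.bdd_mul (c := Real.pi * a) (by fun_prop) (Filter.Eventually.of_forall fun x => hKb _)
  have hKvb : ∀ z, ‖Kv z‖ ≤ Real.pi * a * ∫ z', ‖v z'‖ := by
    intro z
    rw [hKv_eq, ← integral_const_mul]
    refine norm_integral_le_of_norm_le (hv.norm.const_mul _)
      (Filter.Eventually.of_forall fun z' => ?_)
    rw [norm_mul]
    gcongr
    exact hKb _
  have hKv2 : MemLp Kv 2 := memLp_two_of_bounded hKvi hKvb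
  have hF : ∀ s, 𝓕 Kv s = ((a ^ 2 / (a ^ 2 + s ^ 2) : ℝ) : ℂ) * 𝓕 v s := by
    intro s
    rw [hKv, Real.fourier_mul_convolution_eq hKci hv, ← fourier_exp_neg_abs ha]
  have hpars := parseval_of_integrable hv hv2 hKvi hKv2
  have e1 : ∫ s, conj (𝓕 v s) * 𝓕 Kv s
      = ((∫ s, ‖𝓕 v s‖ ^ 2 * (a ^ 2 / (a ^ 2 + s ^ 2)) : ℝ) : ℂ) := by
    rw [← integral_complex_ofReal]
    refine integral_congr_ae (Filter.Eventually.of_forall fun s => ?_)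
    simp only [hF, Complex.ofReal_mul, Complex.ofReal_pow]
    rw [← Complex.conj_mul']
    ring
  have e0 : 𝓕 v 0 = ∫ z, v z := by
    rw [Real.fourier_real_eq_integral_exp_smul]; simp
  have e2 : ((Real.pi * a * ‖𝓕 v 0‖ ^ 2 : ℝ) : ℂ)
      = ∫ z, conj (v z) * (Real.pi * a * ∫ z', v z') := by
    rw [integral_mul_const, integral_conj, ← e0]
    push_cast
    rw [← Complex.conj_mul']
    ring
  have hi1 : Integrable (fun z => conj (v z) * (Real.pi * a * ∫ z', v z')) :=
    (Complex.conjLIE.toContinuousLinearEquiv.integrable_comp_iff.2 hv).mul_const _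
  have hi2 : Integrable (fun z => conj (v z) * Kv z) :=
    (Complex.conjLIE.toContinuousLinearEquiv.integrable_comp_iff.2 hv).mul_bdd
      (c := Real.pi * a * ∫ z', ‖v z'‖) hKvi.1 (Filter.Eventually.of_forall hKvb)
  set N : ℝ := ∫ z, ‖v z‖ with hN
  have hN0 : 0 ≤ N := integral_nonneg fun _ => norm_nonneg _
  have hpt : ∀ z ∈ Set.Ioo 0 δ, ‖Real.pi * a * (∫ z', v z') - Kv z‖
      ≤ 2 * Real.pi ^ 2 * a ^ 2 * δ * N := by
    intro z hz
    rw [hKv_eq, ← integral_const_mul, ← integral_sub (hv.const_mul _) (hint z), hN,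
      ← integral_const_mul]
    refine norm_integral_le_of_norm_le (hv.norm.const_mul _) (Filter.Eventually.of_forall fun z' => ?_)
    by_cases hz' : z' ∈ Set.Ioo 0 δ
    · rw [← sub_mul, norm_mul]
      gcongr
      have hab : |z - z'| ≤ δ := by
        rw [abs_le]; constructor <;> linarith [hz.1, hz.2, hz'.1, hz'.2]
      have : (Real.pi : ℂ) * a - Kc (z - z') = ((Real.pi * a - K (z - z') : ℝ) : ℂ) := by
        simp [hKc]
      rw [this, Complex.norm_real]
      have h1 : 1 - 2 * Real.pi * a * |z - z'| ≤ Real.exp (-(2 * Real.pi * a * |z - z'|)) := by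
        have := Real.add_one_le_exp (-(2 * Real.pi * a * |z - z'|)); linarith
      have h2 : Real.exp (-(2 * Real.pi * a * |z - z'|)) ≤ 1 := by
        refine Real.exp_le_one_iff.2 ?_
        have : 0 ≤ 2 * Real.pi * a * |z - z'| := by positivity
        linarith
      have h3 : 2 * Real.pi * a * |z - z'| ≤ 2 * Real.pi * a * δ := by gcongr
      have h4 : 0 < Real.pi * a := by positivity
      have h5 : Real.pi * a - K (z - z')
        = Real.pi * a * (1 - Real.exp (-(2 * Real.pi * a * |z - z'|))) := by
        simp only [hK]; ring
      rw [h5, Real.norm_of_nonneg (mul_nonneg h4.le (by linarith))]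
      calc _ ≤ Real.pi * a * (2 * Real.pi * a * δ) := by gcongr; linarith
        _ = _ := by ring
    · simp [hsupp z' hz']
  have hCS : N ^ 2 ≤ δ * ∫ z, ‖v z‖ ^ 2 := by
    have := sq_integral_norm_le (by simp) hv hv2 hsupp
    simpa [hδ.le] using this
  have hdiff : ((Real.pi * a * ‖𝓕 v 0‖ ^ 2 - ∫ s, ‖𝓕 v s‖ ^ 2 * (a ^ 2 / (a ^ 2 + s ^ 2)) : ℝ) : ℂ)
      = ∫ z, conj (v z) * (Real.pi * a * (∫ z', v z') - Kv z) := by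
    rw [Complex.ofReal_sub, e2, ← e1, ← hpars, ← integral_sub hi1 hi2]
    simp only [mul_sub]
  rw [← Real.norm_eq_abs, ← Complex.norm_real, hdiff, plancherel hv hv2]
  calc _ ≤ ∫ z, ‖v z‖ * (2 * Real.pi ^ 2 * a ^ 2 * δ * N) := by
        refine norm_integral_le_of_norm_le (hv.norm.mul_const _)
          (Filter.Eventually.of_forall fun z => ?_)
        rw [norm_mul, RCLike.norm_conj]
        by_cases hz : z ∈ Set.Ioo 0 δ
        · gcongr; exact hpt z hz
        · simp [hsupp z hz]
    _ = 2 * Real.pi ^ 2 * a ^ 2 * δ * N ^ 2 := by rw [integral_mul_const]; ring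
    _ ≤ 2 * Real.pi ^ 2 * a ^ 2 * δ * (δ * ∫ z, ‖v z‖ ^ 2) := by gcongr
    _ = _ := by ring

end OneDim

/-! ### The Newtonian energy in Fourier space -/

section Energy

open scoped ComplexConjugate
open Filter Topology

/-- The wave `exp(-2πi ⟨p, ξ⟩)`. -/
noncomputable def planeWave (p ξ : E3) : ℂ :=
  Complex.exp (((-2 * Real.pi * inner ℝ p ξ : ℝ) : ℂ) * Complex.I)

lemma norm_planeWave (p ξ : E3) : ‖planeWave p ξ‖ = 1 := Complex.norm_exp_ofReal_mul_I _

lemma continuous_planeWave : Continuous fun w : E3 × E3 => planeWave w.1 w.2 := by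
  unfold planeWave
  fun_prop

lemma planeWave_sub (p q ξ : E3) : planeWave (p - q) ξ = planeWave p ξ * conj (planeWave q ξ) := by
  simp only [planeWave]
  rw [← Complex.exp_conj, ← Complex.exp_add]
  congr 1
  simp only [inner_sub_left, map_mul, Complex.conj_ofReal, Complex.conj_I]
  push_cast
  ring

/-- Linearity of the integral for the four terms of the energy of a difference `μ - ν`. -/
lemma integral_sub_sub_add {α E : Type*} [MeasurableSpace α] [NormedAddCommGroup E]
    [NormedSpace ℝ E] {m : Measure α} {a b c d : α → E} (ha : Integrable a m)
    (hb : Integrable b m) (hc : Integrable c m) (hd : Integrable d m) :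
    ∫ x, (a x - b x - c x + d x) ∂m
      = ∫ x, a x ∂m - ∫ x, b x ∂m - ∫ x, c x ∂m + ∫ x, d x ∂m := by
  rw [← integral_sub ha hb, ← integral_sub (f := fun x => a x - b x) (ha.sub hb) hc,
    ← integral_add (f := fun x => a x - b x - c x) ((ha.sub hb).sub hc) hd]

/-- The Newtonian kernel as a superposition of Gaussians. For `p = q` both sides are `∞`. -/
lemma inv_edist_eq_lintegral (p q : E3) :
    (edist p q)⁻¹ = 2 * ∫⁻ s in Set.Ioi (0 : ℝ),
      ENNReal.ofReal (Real.exp (-Real.pi * ‖p - q‖ ^ 2 * s ^ 2)) := by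
  have hpi := Real.pi_pos
  rcases eq_or_ne p q with rfl | hpq
  · simp
  have hd : 0 < ‖p - q‖ := norm_pos_iff.2 (sub_ne_zero.2 hpq)
  have hb : 0 < Real.pi * ‖p - q‖ ^ 2 := by positivity
  have hi : IntegrableOn (fun s : ℝ => Real.exp (-Real.pi * ‖p - q‖ ^ 2 * s ^ 2)) (Set.Ioi 0) := by
    have := (integrable_exp_neg_mul_sq hb).integrableOn (s := Set.Ioi 0)
    simpa [neg_mul] using this
  rw [← ofReal_integral_eq_lintegral_ofReal hi
    (Eventually.of_forall fun _ => (Real.exp_pos _).le)]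
  have := integral_gaussian_Ioi (Real.pi * ‖p - q‖ ^ 2)
  simp only [neg_mul] at this ⊢
  have h2 : (2 : ℝ≥0∞) * ENNReal.ofReal (√(Real.pi / (Real.pi * ‖p - q‖ ^ 2)) / 2)
      = ENNReal.ofReal (2 * (√(Real.pi / (Real.pi * ‖p - q‖ ^ 2)) / 2)) := by
    rw [ENNReal.ofReal_mul (by norm_num)]
    simp
  rw [this, edist_dist, dist_eq_norm, ← ENNReal.ofReal_inv_of_pos hd, h2]
  congr 1
  rw [show Real.pi / (Real.pi * ‖p - q‖ ^ 2) = (‖p - q‖⁻¹) ^ 2 by field_simp,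
    Real.sqrt_sq (by positivity)]
  ring

/-- The Gaussians `s⁻³ exp(-A / s²)`, with `A = π |ξ|²`, superpose to a multiple of `1 / |ξ|²`. -/
lemma integrableOn_and_integral_inv_cube_mul_exp {A : ℝ} (hA : 0 < A) :
    IntegrableOn (fun s : ℝ => (s ^ 3)⁻¹ * Real.exp (-A / s ^ 2)) (Set.Ioi 0) ∧
      ∫ s in Set.Ioi (0 : ℝ), (s ^ 3)⁻¹ * Real.exp (-A / s ^ 2) = 1 / (2 * A) := by
  -- The antiderivative, corrected at `0`, where `-A / 0 ^ 2 = 0` would make it discontinuous.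
  set F : ℝ → ℝ := Function.update (fun s => 1 / (2 * A) * Real.exp (-A / s ^ 2)) 0 0 with hF
  have hd : ∀ s ∈ Set.Ioi (0 : ℝ), HasDerivAt F ((s ^ 3)⁻¹ * Real.exp (-A / s ^ 2)) s := by
    intro s (hs : 0 < s)
    have h1 : HasDerivAt (fun s : ℝ => 1 / (2 * A) * Real.exp (-A / s ^ 2))
        ((s ^ 3)⁻¹ * Real.exp (-A / s ^ 2)) s := by
      have := (((hasDerivAt_const s (-A)).div (hasDerivAt_pow 2 s) (by positivity)).exp).const_mul
        (1 / (2 * A))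
      convert! this using 1
      simp only [Pi.div_apply]
      field_simp
      ring
    refine h1.congr_of_eventuallyEq ?_
    filter_upwards [lt_mem_nhds hs] with t ht
    rw [hF, Function.update_of_ne ht.ne']
  have hc : ContinuousWithinAt F (Set.Ici 0) 0 := by
    rw [hF, continuousWithinAt_update_same, Set.Ici_sdiff_left]
    have h1 : Tendsto (fun s : ℝ => -A / s ^ 2) (𝓝[>] 0) atBot := by
      have : Tendsto (fun s : ℝ => (s ^ 2)⁻¹) (𝓝[>] 0) atTop := by
        refine Tendsto.comp tendsto_inv_nhdsGT_zero ?_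
        refine tendsto_nhdsWithin_iff.2 ⟨?_, ?_⟩
        · have : Tendsto (fun s : ℝ => s ^ 2) (𝓝 0) (𝓝 (0 ^ 2)) := (continuous_pow 2).tendsto 0
          simpa using this.mono_left nhdsWithin_le_nhds
        · filter_upwards [self_mem_nhdsWithin] with s hs
          exact pow_pos (Set.mem_Ioi.1 hs) 2
      simpa [div_eq_mul_inv] using this.const_mul_atTop_of_neg (show -A < 0 by linarith)
    simpa using (Real.tendsto_exp_atBot.comp h1).const_mul (1 / (2 * A))
  have hl : Tendsto F atTop (𝓝 (1 / (2 * A))) := by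
    have h1 : Tendsto (fun s : ℝ => -A / s ^ 2) atTop (𝓝 0) :=
      tendsto_const_nhds.div_atTop (tendsto_pow_atTop two_ne_zero)
    have h2 := ((Real.continuous_exp.tendsto 0).comp h1).const_mul (1 / (2 * A))
    rw [Real.exp_zero, mul_one] at h2
    refine h2.congr' ?_
    filter_upwards [eventually_gt_atTop 0] with t ht
    rw [hF, Function.update_of_ne ht.ne']
    rfl
  have hp : ∀ s ∈ Set.Ioi (0 : ℝ), 0 ≤ (s ^ 3)⁻¹ * Real.exp (-A / s ^ 2) := by
    intro s (hs : 0 < s)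
    positivity
  refine ⟨integrableOn_Ioi_deriv_of_nonneg hc hd hp hl, ?_⟩
  rw [integral_Ioi_of_hasDerivAt_of_nonneg hc hd hp hl, hF]
  simp

/-- The mutual energy of two measures for the Gaussian kernel `exp (-π s² |p - q|²)`. -/
noncomputable def gaussEnergy (μ ν : Measure E3) (s : ℝ) : ℝ :=
  ∫ z, Real.exp (-Real.pi * ‖z.1 - z.2‖ ^ 2 * s ^ 2) ∂(μ.prod ν)

lemma gaussEnergy_nonneg (μ ν : Measure E3) (s : ℝ) : 0 ≤ gaussEnergy μ ν s :=
  integral_nonneg fun _ => (Real.exp_pos _).le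

lemma exp_gauss_le_one (p q : E3) (s : ℝ) : Real.exp (-Real.pi * ‖p - q‖ ^ 2 * s ^ 2) ≤ 1 := by
  refine Real.exp_le_one_iff.2 ?_
  have : 0 ≤ Real.pi * ‖p - q‖ ^ 2 * s ^ 2 := by positivity
  linarith

lemma newtonEnergy_mono {μ ν μ' ν' : Measure E3} (h₁ : μ ≤ μ') (h₂ : ν ≤ ν') :
    newtonEnergy μ ν ≤ newtonEnergy μ' ν' := by
  unfold newtonEnergy
  gcongr

variable (μ ν : Measure E3) [IsFiniteMeasure μ] [IsFiniteMeasure ν]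

lemma integrable_gauss (s : ℝ) :
    Integrable (fun z : E3 × E3 => Real.exp (-Real.pi * ‖z.1 - z.2‖ ^ 2 * s ^ 2)) (μ.prod ν) := by
  refine Integrable.of_bound (by fun_prop) 1 (Eventually.of_forall fun z => ?_)
  rw [Real.norm_of_nonneg (Real.exp_pos _).le]
  exact exp_gauss_le_one _ _ _

lemma newtonEnergy_eq_lintegral_gaussEnergy :
    newtonEnergy μ ν = ENNReal.ofReal (1 / (2 * Real.pi)) *
      ∫⁻ s in Set.Ioi (0 : ℝ), ENNReal.ofReal (gaussEnergy μ ν s) := by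
  have h1 : ∫⁻ p, ∫⁻ q, (edist p q)⁻¹ ∂ν ∂μ
      = ∫⁻ z : E3 × E3, (edist z.1 z.2)⁻¹ ∂(μ.prod ν) :=
    (lintegral_prod (fun z : E3 × E3 => (edist z.1 z.2)⁻¹)
      (measurable_fst.edist measurable_snd).inv.aemeasurable).symm
  rw [newtonEnergy, h1]
  simp only [inv_edist_eq_lintegral]
  have hm : Measurable (Function.uncurry fun (z : E3 × E3) (s : ℝ) =>
      ENNReal.ofReal (Real.exp (-Real.pi * ‖z.1 - z.2‖ ^ 2 * s ^ 2))) := by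
    unfold Function.uncurry
    fun_prop
  rw [lintegral_const_mul _ (Measurable.lintegral_prod_right hm),
    lintegral_lintegral_swap hm.aemeasurable, ← mul_assoc]
  congr 1
  · rw [show (2 : ℝ≥0∞) = ENNReal.ofReal 2 by simp, ← ENNReal.ofReal_mul (by positivity)]
    congr 1
    field_simp
    norm_num
  · refine lintegral_congr fun s => ?_
    rw [gaussEnergy, ofReal_integral_eq_lintegral_ofReal (integrable_gauss μ ν s)
      (Eventually.of_forall fun _ => (Real.exp_pos _).le)]

lemma stronglyMeasurable_gaussEnergy : StronglyMeasurable (gaussEnergy μ ν) := by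
  have hc : Continuous (fun w : ℝ × (E3 × E3) =>
    Real.exp (-Real.pi * ‖w.2.1 - w.2.2‖ ^ 2 * w.1 ^ 2)) := by fun_prop
  exact hc.stronglyMeasurable.integral_prod_right'

variable {μ ν}

lemma newtonEnergy_toReal (h : newtonEnergy μ ν ≠ ∞) :
    IntegrableOn (gaussEnergy μ ν) (Set.Ioi 0) ∧
      (newtonEnergy μ ν).toReal = 1 / (2 * Real.pi) * ∫ s in Set.Ioi 0, gaussEnergy μ ν s := by
  have hpi := Real.pi_pos
  rw [newtonEnergy_eq_lintegral_gaussEnergy] at h ⊢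
  have hfin : ∫⁻ s in Set.Ioi (0 : ℝ), ENNReal.ofReal (gaussEnergy μ ν s) ≠ ∞ := by
    intro h'
    rw [h', ENNReal.mul_top (by simp; positivity)] at h
    exact h rfl
  refine ⟨⟨(stronglyMeasurable_gaussEnergy μ ν).aestronglyMeasurable, ?_⟩, ?_⟩
  · rw [hasFiniteIntegral_iff_ofReal (Eventually.of_forall fun s => gaussEnergy_nonneg μ ν s)]
    exact hfin.lt_top
  · rw [ENNReal.toReal_mul, ENNReal.toReal_ofReal (by positivity),
      integral_eq_lintegral_of_nonneg_ae (Eventually.of_forall fun s => gaussEnergy_nonneg μ ν s)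
      (stronglyMeasurable_gaussEnergy μ ν).aestronglyMeasurable]

/-- The Fourier transform `∫ exp(-2πi ⟨p, ξ⟩) dμ(p)` of a measure. -/
noncomputable def measureFourier (μ : Measure E3) (ξ : E3) : ℂ :=
  ∫ p, planeWave p ξ ∂μ

lemma continuous_measureFourier : Continuous (measureFourier μ) := by
  refine continuous_of_dominated (bound := fun _ => 1) (fun ξ => ?_) (fun ξ => ?_) (by simp) ?_
  · exact (continuous_planeWave.comp (Continuous.prodMk_left ξ)).aestronglyMeasurable
  · exact Eventually.of_forall fun p => (norm_planeWave p ξ).le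
  · exact Eventually.of_forall fun p => continuous_planeWave.comp (Continuous.prodMk_right p)

lemma norm_measureFourier_le (ξ : E3) : ‖measureFourier μ ξ‖ ≤ μ.real Set.univ := by
  refine (norm_integral_le_of_norm_le_const (C := 1) (Eventually.of_forall fun p => ?_)).trans ?_
  · exact (norm_planeWave p ξ).le
  · simp

lemma integrable_gauss_freq {s : ℝ} (hs : 0 < s) :
    Integrable (fun ξ : E3 => (s ^ 3)⁻¹ * Real.exp (-(Real.pi * ‖ξ‖ ^ 2) / s ^ 2)) := by
  have hpi := Real.pi_pos
  have := GaussianFourier.integrable_cexp_neg_mul_sq_norm_add (V := E3)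
    (b := ((Real.pi / s ^ 2 : ℝ) : ℂ)) (by rw [Complex.ofReal_re]; positivity) 0 0
  have h2 := (this.norm).const_mul ((s ^ 3)⁻¹)
  refine h2.congr (Eventually.of_forall fun ξ => ?_)
  simp only
  congr 1
  rw [Complex.norm_exp]
  congr 1
  have : -((Real.pi / s ^ 2 : ℝ) : ℂ) * (‖ξ‖ : ℂ) ^ 2 + 0 * ((inner ℝ 0 ξ : ℝ) : ℂ)
      = ((-(Real.pi * ‖ξ‖ ^ 2) / s ^ 2 : ℝ) : ℂ) := by
    push_cast
    ring
  rw [this, Complex.ofReal_re]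

/-- The Gaussian as the Fourier transform of a Gaussian. -/
lemma gauss_eq_fourier {s : ℝ} (hs : 0 < s) (x : E3) :
    ((Real.exp (-Real.pi * ‖x‖ ^ 2 * s ^ 2) : ℝ) : ℂ) =
      ∫ ξ : E3, (((s ^ 3)⁻¹ * Real.exp (-(Real.pi * ‖ξ‖ ^ 2) / s ^ 2) : ℝ) : ℂ) *
        planeWave x ξ := by
  have hpi := Real.pi_pos
  have h := fourier_gaussian_innerProductSpace (V := E3) (b := ((Real.pi / s ^ 2 : ℝ) : ℂ))
    (by rw [Complex.ofReal_re]; positivity) x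
  have hb : (Real.pi : ℂ) / ((Real.pi / s ^ 2 : ℝ) : ℂ) = ((s ^ 2 : ℝ) : ℂ) := by
    rw [← Complex.ofReal_div]; congr 1; field_simp
  have hpow : ((s ^ 2 : ℝ) : ℂ) ^ ((Module.finrank ℝ E3 : ℂ) / 2) = ((s ^ 3 : ℝ) : ℂ) := by
    have e3 : (Module.finrank ℝ E3 : ℂ) / 2 = (((3 : ℝ) / 2 : ℝ) : ℂ) := by simp
    rw [e3, ← Complex.ofReal_cpow (by positivity)]
    congr 1
    rw [← Real.rpow_natCast s 2, ← Real.rpow_mul hs.le]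
    norm_num
  rw [hb, hpow, Real.fourier_eq'] at h
  have h2 : Complex.exp (-(Real.pi : ℂ) ^ 2 * ‖x‖ ^ 2 / ((Real.pi / s ^ 2 : ℝ) : ℂ))
      = ((Real.exp (-Real.pi * ‖x‖ ^ 2 * s ^ 2) : ℝ) : ℂ) := by
    have hp' : (Real.pi : ℂ) ≠ 0 := by exact_mod_cast hpi.ne'
    have hs' : (s : ℂ) ≠ 0 := by exact_mod_cast hs.ne'
    push_cast
    congr 1
    field_simp
  rw [h2] at h
  have hs3 : ((s ^ 3 : ℝ) : ℂ) ≠ 0 := by exact_mod_cast (pow_pos hs 3).ne'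
  rw [← mul_right_inj' hs3, ← h, ← integral_const_mul]
  refine integral_congr_ae (Eventually.of_forall fun ξ => ?_)
  simp only [smul_eq_mul, planeWave, real_inner_comm x ξ]
  have : Complex.exp (-((Real.pi / s ^ 2 : ℝ) : ℂ) * (‖ξ‖ : ℂ) ^ 2)
      = ((Real.exp (-(Real.pi * ‖ξ‖ ^ 2) / s ^ 2) : ℝ) : ℂ) := by
    push_cast
    congr 1
    ring
  rw [this]
  have hs' : (s : ℂ) ≠ 0 := by exact_mod_cast hs.ne'
  push_cast
  field_simp

lemma gaussEnergy_eq_fourier {s : ℝ} (hs : 0 < s) :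
    (gaussEnergy μ ν s : ℂ) =
      ∫ ξ : E3, (((s ^ 3)⁻¹ * Real.exp (-(Real.pi * ‖ξ‖ ^ 2) / s ^ 2) : ℝ) : ℂ) *
        (measureFourier μ ξ * conj (measureFourier ν ξ)) := by
  rw [gaussEnergy, ← integral_complex_ofReal]
  simp only [gauss_eq_fourier hs]
  rw [integral_integral_swap]
  · refine integral_congr_ae (Eventually.of_forall fun ξ => ?_)
    simp only
    rw [integral_const_mul]
    congr 1
    rw [measureFourier, measureFourier, ← integral_conj, ← integral_prod_mul]
    refine integral_congr_ae (Eventually.of_forall fun z => ?_)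
    exact planeWave_sub _ _ _
  · have h0 : Integrable (fun ξ : E3 =>
        (((s ^ 3)⁻¹ * Real.exp (-(Real.pi * ‖ξ‖ ^ 2) / s ^ 2) : ℝ) : ℂ)) :=
      (integrable_gauss_freq hs).ofReal
    have h1 : Integrable (fun w : (E3 × E3) × E3 =>
        (((s ^ 3)⁻¹ * Real.exp (-(Real.pi * ‖w.2‖ ^ 2) / s ^ 2) : ℝ) : ℂ))
        ((μ.prod ν).prod volume) := h0.comp_snd (μ.prod ν)
    refine h1.mul_bdd (c := 1) ?_ (Eventually.of_forall fun w => (norm_planeWave _ _).le)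
    refine Continuous.aestronglyMeasurable ?_
    exact continuous_planeWave.comp
      (f := fun w : (E3 × E3) × E3 => (w.1.1 - w.1.2, w.2)) (by fun_prop)

lemma integrable_gauss_mul_bounded {s : ℝ} (hs : 0 < s) {f : E3 → ℂ} (hf : Continuous f)
    {C : ℝ} (hC : ∀ ξ, ‖f ξ‖ ≤ C) :
    Integrable (fun ξ : E3 =>
      (((s ^ 3)⁻¹ * Real.exp (-(Real.pi * ‖ξ‖ ^ 2) / s ^ 2) : ℝ) : ℂ) * f ξ) :=
  (integrable_gauss_freq hs).ofReal.mul_bdd (c := C) hf.aestronglyMeasurable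
    (Eventually.of_forall hC)

/-- The Gaussian energy of `μ - ν` is nonnegative, as its Fourier representation shows; hence
Tonelli's theorem applies to the superposition over `s`. -/
lemma gaussEnergy_signed_eq_fourier {s : ℝ} (hs : 0 < s) :
    gaussEnergy μ μ s - gaussEnergy μ ν s - gaussEnergy ν μ s + gaussEnergy ν ν s =
      ∫ ξ : E3, (s ^ 3)⁻¹ * Real.exp (-(Real.pi * ‖ξ‖ ^ 2) / s ^ 2) *
        ‖measureFourier μ ξ - measureFourier ν ξ‖ ^ 2 := by
  have hi : ∀ (a b : Measure E3) [IsFiniteMeasure a] [IsFiniteMeasure b], Integrable (fun ξ : E3 =>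
      (((s ^ 3)⁻¹ * Real.exp (-(Real.pi * ‖ξ‖ ^ 2) / s ^ 2) : ℝ) : ℂ) *
        (measureFourier a ξ * conj (measureFourier b ξ))) := by
    intro a b _ _
    refine integrable_gauss_mul_bounded hs (C := a.real Set.univ * b.real Set.univ)
      (continuous_measureFourier.mul (Complex.continuous_conj.comp continuous_measureFourier))
      fun ξ => ?_
    rw [norm_mul, RCLike.norm_conj]
    exact mul_le_mul (norm_measureFourier_le ξ) (norm_measureFourier_le ξ) (norm_nonneg _)
      (by positivity)
  have : ((gaussEnergy μ μ s - gaussEnergy μ ν s - gaussEnergy ν μ s + gaussEnergy ν ν s : ℝ) : ℂ)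
      = ((∫ ξ : E3, (s ^ 3)⁻¹ * Real.exp (-(Real.pi * ‖ξ‖ ^ 2) / s ^ 2) *
        ‖measureFourier μ ξ - measureFourier ν ξ‖ ^ 2 : ℝ) : ℂ) := by
    rw [← integral_complex_ofReal]
    push_cast
    rw [gaussEnergy_eq_fourier hs, gaussEnergy_eq_fourier hs, gaussEnergy_eq_fourier hs,
      gaussEnergy_eq_fourier hs, ← integral_sub_sub_add (hi μ μ) (hi μ ν) (hi ν μ) (hi ν ν)]
    refine integral_congr_ae (Eventually.of_forall fun ξ => ?_)
    simp only
    rw [← Complex.mul_conj', map_sub]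
    push_cast
    ring
  exact_mod_cast this

/-- The Newtonian energy of a signed measure `μ - ν` in Fourier space: the symbol of `(-Δ)⁻¹` is
`1 / (4π² |ξ|²)`. -/
theorem signed_newtonEnergy_eq_fourier (h : newtonEnergy (μ + ν) (μ + ν) ≠ ∞) :
    (newtonEnergy μ μ).toReal - (newtonEnergy μ ν).toReal
      - (newtonEnergy ν μ).toReal + (newtonEnergy ν ν).toReal
      = ∫ ξ : E3, ‖measureFourier μ ξ - measureFourier ν ξ‖ ^ 2 / (4 * Real.pi ^ 2 * ‖ξ‖ ^ 2) := by
  have hpi := Real.pi_pos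
  have hμ : μ ≤ μ + ν := Measure.le_add_right le_rfl
  have hν : ν ≤ μ + ν := Measure.le_add_left le_rfl
  obtain ⟨i₁, e₁⟩ := newtonEnergy_toReal (ne_top_of_le_ne_top h (newtonEnergy_mono hμ hμ))
  obtain ⟨i₂, e₂⟩ := newtonEnergy_toReal (ne_top_of_le_ne_top h (newtonEnergy_mono hμ hν))
  obtain ⟨i₃, e₃⟩ := newtonEnergy_toReal (ne_top_of_le_ne_top h (newtonEnergy_mono hν hμ))
  obtain ⟨i₄, e₄⟩ := newtonEnergy_toReal (ne_top_of_le_ne_top h (newtonEnergy_mono hν hν))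
  set m : E3 → ℂ := fun ξ => measureFourier μ ξ - measureFourier ν ξ with hm
  have hmc : Continuous m := continuous_measureFourier.sub continuous_measureFourier
  set T : ℝ → ℝ := fun s =>
    gaussEnergy μ μ s - gaussEnergy μ ν s - gaussEnergy ν μ s + gaussEnergy ν ν s with hT
  have iT : IntegrableOn T (Set.Ioi 0) := ((i₁.sub i₂).sub i₃).add i₄
  have hTf : ∀ s ∈ Set.Ioi (0 : ℝ), T s = ∫ ξ : E3,
      (s ^ 3)⁻¹ * Real.exp (-(Real.pi * ‖ξ‖ ^ 2) / s ^ 2) * ‖m ξ‖ ^ 2 :=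
    fun s hs => gaussEnergy_signed_eq_fourier hs
  have hnn : ∀ s ∈ Set.Ioi (0 : ℝ), ∀ ξ : E3,
      0 ≤ (s ^ 3)⁻¹ * Real.exp (-(Real.pi * ‖ξ‖ ^ 2) / s ^ 2) * ‖m ξ‖ ^ 2 := by
    intro s (hs : 0 < s) ξ
    positivity
  have hT0 : ∀ s ∈ Set.Ioi (0 : ℝ), 0 ≤ T s := fun s hs => by
    rw [hTf s hs]; exact integral_nonneg (hnn s hs)
  have hmi : ∀ s ∈ Set.Ioi (0 : ℝ), Integrable (fun ξ : E3 =>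
      (s ^ 3)⁻¹ * Real.exp (-(Real.pi * ‖ξ‖ ^ 2) / s ^ 2) * ‖m ξ‖ ^ 2) := by
    intro s hs
    refine (integrable_gauss_freq hs).mul_bdd (c := (μ.real Set.univ + ν.real Set.univ) ^ 2)
      (by fun_prop) (Eventually.of_forall fun ξ => ?_)
    rw [norm_pow, norm_norm]
    gcongr
    exact (norm_sub_le _ _).trans (add_le_add (norm_measureFourier_le ξ) (norm_measureFourier_le ξ))
  have e : (newtonEnergy μ μ).toReal - (newtonEnergy μ ν).toReal
      - (newtonEnergy ν μ).toReal + (newtonEnergy ν ν).toReal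
      = 1 / (2 * Real.pi) * ∫ s in Set.Ioi 0, T s := by
    rw [e₁, e₂, e₃, e₄]
    have : ∫ s in Set.Ioi 0, T s = (∫ s in Set.Ioi 0, gaussEnergy μ μ s)
        - (∫ s in Set.Ioi 0, gaussEnergy μ ν s) - (∫ s in Set.Ioi 0, gaussEnergy ν μ s)
        + ∫ s in Set.Ioi 0, gaussEnergy ν ν s := integral_sub_sub_add i₁ i₂ i₃ i₄
    rw [this]
    ring
  rw [e]
  have hset : ∫ s in Set.Ioi 0, T s = (∫⁻ s in Set.Ioi 0, ENNReal.ofReal (T s)).toReal :=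
    integral_eq_lintegral_of_nonneg_ae ((ae_restrict_iff' measurableSet_Ioi).2
      (Eventually.of_forall hT0)) iT.1
  have hsw : ∫⁻ s in Set.Ioi 0, ENNReal.ofReal (T s) =
      ∫⁻ ξ : E3, ENNReal.ofReal (‖m ξ‖ ^ 2 / (2 * Real.pi * ‖ξ‖ ^ 2)) := by
    have hmeas : Measurable (Function.uncurry fun (s : ℝ) (ξ : E3) => ENNReal.ofReal
        ((s ^ 3)⁻¹ * Real.exp (-(Real.pi * ‖ξ‖ ^ 2) / s ^ 2) * ‖m ξ‖ ^ 2)) := by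
      have := hmc.measurable
      unfold Function.uncurry
      fun_prop
    calc ∫⁻ s in Set.Ioi 0, ENNReal.ofReal (T s)
        = ∫⁻ s in Set.Ioi 0, ∫⁻ ξ : E3, ENNReal.ofReal
          ((s ^ 3)⁻¹ * Real.exp (-(Real.pi * ‖ξ‖ ^ 2) / s ^ 2) * ‖m ξ‖ ^ 2) := by
          refine setLIntegral_congr_fun measurableSet_Ioi fun s hs => ?_
          rw [hTf s hs, ofReal_integral_eq_lintegral_ofReal (hmi s hs)
            (Eventually.of_forall (hnn s hs))]
      _ = ∫⁻ ξ : E3, ∫⁻ s in Set.Ioi 0, ENNReal.ofReal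
          ((s ^ 3)⁻¹ * Real.exp (-(Real.pi * ‖ξ‖ ^ 2) / s ^ 2) * ‖m ξ‖ ^ 2) :=
          lintegral_lintegral_swap hmeas.aemeasurable
      _ = _ := by
          refine lintegral_congr_ae ?_
          filter_upwards [compl_mem_ae_iff.2 (measure_singleton (0 : E3))] with ξ hξ
          have hξ' : 0 < ‖ξ‖ := norm_pos_iff.2 hξ
          obtain ⟨j, ej⟩ := integrableOn_and_integral_inv_cube_mul_exp
            (A := Real.pi * ‖ξ‖ ^ 2) (by positivity)
          rw [← ofReal_integral_eq_lintegral_ofReal (j.mul_const _)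
            ((ae_restrict_iff' measurableSet_Ioi).2 (Eventually.of_forall fun s hs => hnn s hs ξ)),
            integral_mul_const, ej]
          congr 1
          field_simp
  have hmeas' : Measurable fun ξ : E3 => ‖m ξ‖ ^ 2 / (4 * Real.pi ^ 2 * ‖ξ‖ ^ 2) :=
    (hmc.measurable.norm.pow_const 2).div (by fun_prop)
  rw [hset, hsw, integral_eq_lintegral_of_nonneg_ae (Eventually.of_forall fun ξ => by positivity)
    hmeas'.aestronglyMeasurable,
    ← ENNReal.toReal_ofReal (show 0 ≤ 1 / (2 * Real.pi) by positivity), ← ENNReal.toReal_mul,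
    ← lintegral_const_mul' _ _ ENNReal.ofReal_ne_top]
  congr 1
  refine lintegral_congr fun ξ => ?_
  rw [← ENNReal.ofReal_mul (by positivity)]
  congr 1
  simp only [hm]
  ring

end Energy

/-! ### Slicing space into horizontal planes -/

section Slicing

open scoped ComplexConjugate
open Filter Topology

lemma continuous_planar : Continuous planar := by
  unfold planar; fun_prop

lemma continuous_atHeight : Continuous fun w : E2 × ℝ => atHeight w.1 w.2 := by
  unfold atHeight; fun_prop

@[simp] lemma planar_atHeight (r : E2) (z : ℝ) : planar (atHeight r z) = r := by
  ext i; fin_cases i <;> simp [planar, atHeight]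

@[simp] lemma atHeight_two (r : E2) (z : ℝ) : atHeight r z 2 = z := by
  simp [atHeight]

@[simp] lemma atHeight_planar (p : E3) : atHeight (planar p) (p 2) = p := by
  ext i; fin_cases i <;> simp [planar, atHeight]

lemma inner_eq_planar_add (p q : E3) :
    inner ℝ p q = inner ℝ (planar p) (planar q) + p 2 * q 2 := by
  simp [PiLp.inner_apply, Fin.sum_univ_three, Fin.sum_univ_two, planar]
  ring

lemma norm_sq_eq_planar_add (p : E3) : ‖p‖ ^ 2 = ‖planar p‖ ^ 2 + p 2 ^ 2 := by
  rw [← real_inner_self_eq_norm_sq, ← real_inner_self_eq_norm_sq, inner_eq_planar_add, sq]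

lemma planar_sub (p q : E3) : planar (p - q) = planar p - planar q := by
  ext i; fin_cases i <;> simp [planar]

lemma norm_planar_le (p : E3) : ‖planar p‖ ≤ ‖p‖ := by
  rw [← sq_le_sq₀ (norm_nonneg _) (norm_nonneg _), norm_sq_eq_planar_add]
  nlinarith [sq_nonneg (p 2)]

/-- The splitting of `ℝ³` into the plane and the vertical axis. -/
noncomputable def sliceEquiv : E3 ≃ᵐ E2 × ℝ where
  toFun p := (planar p, p 2)
  invFun w := atHeight w.1 w.2
  left_inv p := by simp
  right_inv w := by simp
  measurable_toFun := by
    exact continuous_planar.measurable.prodMk (by fun_prop)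
  measurable_invFun := continuous_atHeight.measurable

lemma measurePreserving_sliceEquiv : MeasurePreserving sliceEquiv := by
  have h1 : MeasurePreserving (MeasurableEquiv.piFinSuccAbove (fun _ : Fin 3 => ℝ) 2)
      (volume : Measure (Fin 3 → ℝ)) (volume : Measure (ℝ × (Fin 2 → ℝ))) :=
    volume_preserving_piFinSuccAbove (fun _ => ℝ) 2
  have h2 : MeasurePreserving (fun w : ℝ × (Fin 2 → ℝ) => (WithLp.toLp 2 w.2, w.1))
      (volume : Measure (ℝ × (Fin 2 → ℝ))) (volume : Measure (E2 × ℝ)) :=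
    ((PiLp.volume_preserving_toLp (Fin 2)).prod (MeasurePreserving.id (volume : Measure ℝ))).comp
      Measure.measurePreserving_swap
  convert! (h2.comp h1).comp (PiLp.volume_preserving_ofLp (Fin 3)) using 1
  ext p
  · rename_i i
    fin_cases i <;> rfl
  · rfl

variable {E : Type*} [NormedAddCommGroup E]

lemma integrable_slice_iff {f : E3 → E} :
    Integrable (fun w : E2 × ℝ => f (atHeight w.1 w.2)) ↔ Integrable f :=
  measurePreserving_sliceEquiv.symm.integrable_comp_emb sliceEquiv.symm.measurableEmbedding

lemma integral_slice [NormedSpace ℝ E] (f : E3 → E) :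
    ∫ w : E2 × ℝ, f (atHeight w.1 w.2) = ∫ p, f p :=
  measurePreserving_sliceEquiv.symm.integral_comp' f

end Slicing

/-! ### The film estimate in Fourier space -/

section FilmFourier

open scoped ComplexConjugate
open Filter Topology

/-- A square integrable function on `ℝ³` that lives in a bounded part of the slab `0 < z < δ`. -/
structure IsSlabFunction (δ R : ℝ) (u : E3 → ℝ) : Prop where
  memLp : MemLp u 2
  eq_zero : ∀ p, ¬ (planar p ∈ Metric.ball 0 R ∧ p 2 ∈ Set.Ioo 0 δ) → u p = 0

/-- The part of the slab `0 < z < δ` over the disc of radius `R`. -/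
def slabSet (δ R : ℝ) : Set E3 := {p | planar p ∈ Metric.ball (0 : E2) R ∧ p 2 ∈ Set.Ioo 0 δ}

lemma measurableSet_slabSet (δ R : ℝ) : MeasurableSet (slabSet δ R) := by
  have := continuous_planar.measurable
  exact (this measurableSet_ball).inter
    ((show Measurable fun p : E3 => p 2 by fun_prop) measurableSet_Ioo)

lemma volume_slabSet_lt_top (δ R : ℝ) : volume (slabSet δ R) < ∞ := by
  have h : slabSet δ R = sliceEquiv ⁻¹' (Metric.ball (0 : E2) R ×ˢ Set.Ioo 0 δ) := rfl
  rw [h, measurePreserving_sliceEquiv.measure_preimage_equiv, Measure.volume_eq_prod,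
    Measure.prod_prod]
  exact ENNReal.mul_lt_top measure_ball_lt_top (by simp)

variable {δ R : ℝ} {u : E3 → ℝ}

lemma IsSlabFunction.integrable (hu : IsSlabFunction δ R u) : Integrable u := by
  have h : MemLp u 1 (volume.restrict (slabSet δ R)) := by
    have : IsFiniteMeasure (volume.restrict (slabSet δ R)) :=
      ⟨by simpa using volume_slabSet_lt_top δ R⟩
    exact hu.memLp.restrict _ |>.mono_exponent (by norm_num)
  have h2 : IntegrableOn u (slabSet δ R) := memLp_one_iff_integrable.1 h
  exact h2.integrable_of_forall_notMem_eq_zero fun p hp => hu.eq_zero p hp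

/-- The partial Fourier transform of `u` in the plane, at frequency `k` and height `z`. -/
noncomputable def planarFourier (u : E3 → ℝ) (k : E2) (z : ℝ) : ℂ :=
  ∫ r : E2, Complex.exp (((-2 * Real.pi * inner ℝ r k : ℝ) : ℂ) * Complex.I) * u (atHeight r z)

lemma planarFourier_eq_zero (hu : IsSlabFunction δ R u) (k : E2) {z : ℝ} (hz : z ∉ Set.Ioo 0 δ) :
    planarFourier u k z = 0 := by
  have : ∀ r, u (atHeight r z) = 0 := fun r => hu.eq_zero _ (by simp [hz])
  simp [planarFourier, this]

lemma integrable_wave_mul (hu : IsSlabFunction δ R u) (k : E2) (s : ℝ) :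
    Integrable (fun w : E2 × ℝ =>
      Complex.exp (((-2 * Real.pi * (inner ℝ w.1 k + w.2 * s) : ℝ) : ℂ) * Complex.I) *
        u (atHeight w.1 w.2)) := by
  refine ((integrable_slice_iff.2 hu.integrable).ofReal (𝕜 := ℂ)).bdd_mul (c := 1) ?_ ?_
  · exact Continuous.aestronglyMeasurable (by fun_prop)
  · exact Eventually.of_forall fun w => (Complex.norm_exp_ofReal_mul_I _).le

lemma fourier_eq_slice (u : E3 → ℝ) (k : E2) (s : ℝ) :
    𝓕 (fun p => (u p : ℂ)) (atHeight k s) = ∫ w : E2 × ℝ,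
      Complex.exp (((-2 * Real.pi * (inner ℝ w.1 k + w.2 * s) : ℝ) : ℂ) * Complex.I) *
        u (atHeight w.1 w.2) := by
  rw [Real.fourier_eq', ← integral_slice]
  refine integral_congr_ae (Eventually.of_forall fun w => ?_)
  simp [inner_eq_planar_add]

/-- Transforming first in the plane and then in the vertical direction gives the transform in
space. -/
lemma fourier_planarFourier (hu : IsSlabFunction δ R u) (k : E2) (s : ℝ) :
    𝓕 (planarFourier u k) s = 𝓕 (fun p => (u p : ℂ)) (atHeight k s) := by
  rw [fourier_eq_slice, Measure.volume_eq_prod, integral_prod_symm _ (integrable_wave_mul hu k s),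
    Real.fourier_real_eq_integral_exp_smul]
  refine integral_congr_ae (Eventually.of_forall fun z => ?_)
  simp only [planarFourier]
  rw [smul_eq_mul, ← integral_const_mul]
  refine integral_congr_ae (Eventually.of_forall fun r => ?_)
  simp only
  rw [← mul_assoc, ← Complex.exp_add]
  congr 2
  push_cast
  ring

lemma integrable_planarFourier (hu : IsSlabFunction δ R u) (k : E2) :
    Integrable (planarFourier u k) := by
  have := (integrable_wave_mul hu k 0)
  rw [Measure.volume_eq_prod] at this
  have h := this.integral_prod_right
  simp only [mul_zero, add_zero] at h
  exact h

/-- Square integrability holds at every in-plane frequency, not just at almost every one, because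
`u` has bounded support. -/
lemma memLp_planarFourier (hu : IsSlabFunction δ R u) (k : E2) :
    MemLp (planarFourier u k) 2 := by
  have hm := (integrable_planarFourier hu k).1
  rw [memLp_two_iff_integrable_sq_norm hm]
  have h1 : Integrable (fun w : E2 × ℝ => u (atHeight w.1 w.2))
    ((volume : Measure E2).prod volume) := integrable_slice_iff.2 hu.integrable
  have h2 : Integrable (fun w : E2 × ℝ => ‖u (atHeight w.1 w.2)‖ ^ 2)
    ((volume : Measure E2).prod volume) :=
    (integrable_slice_iff (f := fun p => ‖u p‖ ^ 2)).2
      ((memLp_two_iff_integrable_sq_norm hu.integrable.1).1 hu.memLp)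
  refine (h2.integral_prod_right.const_mul (volume.real (Metric.ball (0 : E2) R))).mono'
    (by fun_prop) ?_
  filter_upwards [h1.prod_left_ae, h2.prod_left_ae] with z hz1 hz2
  rw [norm_pow, norm_norm]
  refine le_trans ?_ (sq_integral_norm_le (measure_ball_lt_top).ne hz1
    ((memLp_two_iff_integrable_sq_norm hz1.1).2 hz2) fun r hr => hu.eq_zero _ (by simp at hr; simp [hr]))
  gcongr
  refine norm_integral_le_of_norm_le hz1.norm (Eventually.of_forall fun r => ?_)
  rw [norm_mul, Complex.norm_exp_ofReal_mul_I, one_mul, Complex.norm_real]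

/-- The vertical average is the value at vertical frequency `0`. -/
lemma fourier_average (hu : IsSlabFunction δ R u) (k : E2) :
    𝓕 (fun r => ((δ⁻¹ * ∫ z, u (atHeight r z) : ℝ) : ℂ)) k
      = (δ⁻¹ : ℝ) * 𝓕 (planarFourier u k) 0 := by
  rw [fourier_planarFourier hu, fourier_eq_slice, Measure.volume_eq_prod,
    integral_prod _ (integrable_wave_mul hu k 0), Real.fourier_eq', ← integral_const_mul]
  refine integral_congr_ae (Eventually.of_forall fun r => ?_)
  simp only [mul_zero, add_zero, smul_eq_mul]
  rw [integral_const_mul]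
  push_cast
  rw [← integral_complex_ofReal]
  ring

lemma integrable_average (hu : IsSlabFunction δ R u) :
    Integrable (fun r => δ⁻¹ * ∫ z, u (atHeight r z)) := by
  have h1 : Integrable (fun w : E2 × ℝ => u (atHeight w.1 w.2))
    ((volume : Measure E2).prod volume) := integrable_slice_iff.2 hu.integrable
  exact h1.integral_prod_left.const_mul _

lemma memLp_average (hδ : 0 < δ) (hu : IsSlabFunction δ R u) :
    MemLp (fun r => δ⁻¹ * ∫ z, u (atHeight r z)) 2 := by
  have h1 : Integrable (fun w : E2 × ℝ => u (atHeight w.1 w.2))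
    ((volume : Measure E2).prod volume) := integrable_slice_iff.2 hu.integrable
  have h2 : Integrable (fun w : E2 × ℝ => ‖u (atHeight w.1 w.2)‖ ^ 2)
    ((volume : Measure E2).prod volume) :=
    (integrable_slice_iff (f := fun p => ‖u p‖ ^ 2)).2
      ((memLp_two_iff_integrable_sq_norm hu.integrable.1).1 hu.memLp)
  refine MemLp.const_mul ?_ _
  rw [memLp_two_iff_integrable_sq_norm h1.integral_prod_left.1]
  refine (h2.integral_prod_left.const_mul δ).mono'
    (h1.integral_prod_left.1.norm.pow 2) ?_
  filter_upwards [h1.prod_right_ae, h2.prod_right_ae] with r hr1 hr2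
  rw [norm_pow, norm_norm]
  have := (sq_integral_norm_le (S := Set.Ioo 0 δ) (by simp) hr1
    ((memLp_two_iff_integrable_sq_norm hr1.1).2 hr2)
    fun z hz => hu.eq_zero _ (by simp at hz; simpa using fun _ => hz))
  simp only [Real.volume_real_Ioo_of_le hδ.le, sub_zero] at this
  refine le_trans ?_ this
  gcongr
  exact norm_integral_le_integral_norm _

/-- The film estimate in Fourier space. At each in-plane frequency it is
`abs_poisson_sub_mean_le`, applied to the partial Fourier transform of `u`. -/
theorem film_fourier_estimate (hδ : 0 < δ) (hu : IsSlabFunction δ R u)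
    (hQ : Integrable fun ξ : E3 => ‖planar ξ‖ ^ 2 * ‖𝓕 (fun p => (u p : ℂ)) ξ‖ ^ 2) :
    MemLp (fun k => ((2 * Real.pi * ‖k‖ : ℝ) : ℂ) *
        𝓕 (fun r => ((δ⁻¹ * ∫ z, u (atHeight r z) : ℝ) : ℂ)) k) 2 ∧
      |(∫ ξ : E3, ‖𝓕 (fun p => (u p : ℂ)) ξ‖ ^ 2 * (ξ 2 ^ 2 / ‖ξ‖ ^ 2)) - (∫ p, u p ^ 2)
        + δ ^ 2 / 2 * ∫ k : E2, 2 * Real.pi * ‖k‖ *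
          ‖𝓕 (fun r => ((δ⁻¹ * ∫ z, u (atHeight r z) : ℝ) : ℂ)) k‖ ^ 2|
      ≤ δ ^ 2 / 2 * (4 * Real.pi ^ 2 *
        ∫ ξ : E3, ‖planar ξ‖ ^ 2 * ‖𝓕 (fun p => (u p : ℂ)) ξ‖ ^ 2) := by
  have hpi := Real.pi_pos
  have hui : Integrable (fun p => (u p : ℂ)) := hu.integrable.ofReal
  have hu2 : MemLp (fun p => (u p : ℂ)) 2 := hu.memLp.ofReal
  set U := 𝓕 (fun p => (u p : ℂ)) with hU
  set W := 𝓕 (fun r => ((δ⁻¹ * ∫ z, u (atHeight r z) : ℝ) : ℂ)) with hW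
  have hUc : Continuous U := continuous_fourier hui
  have hWc : Continuous W := continuous_fourier (integrable_average hu).ofReal
  have hU2 : Integrable fun ξ => ‖U ξ‖ ^ 2 :=
    (memLp_two_iff_integrable_sq_norm hUc.aestronglyMeasurable).1 (memLp_fourier hui hu2)
  have hpar : ∫ ξ, ‖U ξ‖ ^ 2 = ∫ p, u p ^ 2 := by
    rw [plancherel hui hu2]
    simp
  -- The part of the energy carried by the in-plane symbol.
  set b : E3 → ℝ := fun ξ => ‖U ξ‖ ^ 2 * (‖planar ξ‖ ^ 2 / ‖ξ‖ ^ 2) with hb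
  have hbi : Integrable b := by
    refine hU2.mul_bdd (c := 1) ?_ (Eventually.of_forall fun ξ => ?_)
    · exact ((continuous_planar.measurable.norm.pow_const 2).div
        (by fun_prop)).aestronglyMeasurable
    · rw [Real.norm_of_nonneg (by positivity)]
      refine div_le_one_of_le₀ ?_ (by positivity)
      gcongr
      exact norm_planar_le ξ
  have hE : ∫ ξ : E3, ‖U ξ‖ ^ 2 * (ξ 2 ^ 2 / ‖ξ‖ ^ 2) = (∫ p, u p ^ 2) - ∫ ξ, b ξ := by
    rw [← hpar, ← integral_sub hU2 hbi]
    refine integral_congr_ae ?_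
    filter_upwards [compl_mem_ae_iff.2 (measure_singleton (0 : E3))] with ξ hξ
    have hξ' : 0 < ‖ξ‖ := norm_pos_iff.2 hξ
    have := norm_sq_eq_planar_add ξ
    have h2 : ξ 2 ^ 2 / ‖ξ‖ ^ 2 = 1 - ‖planar ξ‖ ^ 2 / ‖ξ‖ ^ 2 := by
      rw [eq_sub_iff_add_eq, ← add_div, div_eq_one_iff_eq (by positivity)]
      linarith
    simp only [hb, h2]
    ring
  set A : E2 → ℝ := fun k => Real.pi * ‖k‖ * ‖𝓕 (planarFourier u k) 0‖ ^ 2 with hA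
  set B : E2 → ℝ := fun k => ∫ s, ‖U (atHeight k s)‖ ^ 2 * (‖k‖ ^ 2 / (‖k‖ ^ 2 + s ^ 2)) with hB
  set C : E2 → ℝ := fun k => ∫ s, ‖k‖ ^ 2 * ‖U (atHeight k s)‖ ^ 2 with hC
  have hF0 : ∀ k, 𝓕 (planarFourier u k) 0 = δ * W k := by
    intro k
    rw [hW, fourier_average hu, ← mul_assoc, ← Complex.ofReal_mul, mul_inv_cancel₀ hδ.ne']
    simp
  have hb_slice : ∀ (k : E2) (s : ℝ), b (atHeight k s)
      = ‖U (atHeight k s)‖ ^ 2 * (‖k‖ ^ 2 / (‖k‖ ^ 2 + s ^ 2)) := by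
    intro k s
    simp [hb, norm_sq_eq_planar_add]
  have hb' : Integrable (fun w : E2 × ℝ => b (atHeight w.1 w.2))
    ((volume : Measure E2).prod volume) := integrable_slice_iff.2 hbi
  have hQ' : Integrable (fun w : E2 × ℝ => ‖planar (atHeight w.1 w.2)‖ ^ 2 *
      ‖U (atHeight w.1 w.2)‖ ^ 2) ((volume : Measure E2).prod volume) :=
    (integrable_slice_iff (f := fun ξ => ‖planar ξ‖ ^ 2 * ‖U ξ‖ ^ 2)).2 hQ
  have hBi : Integrable B := by
    have := hb'.integral_prod_left
    simpa only [hb_slice] using this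
  have hCi : Integrable C := by
    have := hQ'.integral_prod_left
    simpa only [planar_atHeight] using this
  have hBint : ∫ k, B k = ∫ ξ, b ξ := by
    rw [← integral_slice, Measure.volume_eq_prod, integral_prod _ hb']
    simp only [hb_slice, hB]
  have hCint : ∫ k, C k = ∫ ξ : E3, ‖planar ξ‖ ^ 2 * ‖U ξ‖ ^ 2 := by
    rw [← integral_slice (fun ξ : E3 => ‖planar ξ‖ ^ 2 * ‖U ξ‖ ^ 2), Measure.volume_eq_prod,
      integral_prod _ hQ']
    simp only [planar_atHeight, hC]
  have hC_eq : ∀ k, C k = ‖k‖ ^ 2 * ∫ s, ‖U (atHeight k s)‖ ^ 2 := fun k =>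
    integral_const_mul _ _
  have hAB : ∀ k, |A k - B k| ≤ 2 * Real.pi ^ 2 * δ ^ 2 * C k := by
    intro k
    have := abs_poisson_sub_mean_le hδ (norm_nonneg k) (integrable_planarFourier hu k)
      (memLp_planarFourier hu k) fun z hz => planarFourier_eq_zero hu k hz
    simp only [hA, hB, hC_eq, hU, ← fourier_planarFourier hu]
    refine this.trans (le_of_eq ?_)
    ring
  have hAc : Continuous A := by
    simp only [hA, hF0]
    fun_prop
  have hABi : Integrable (fun k => A k - B k) :=
    (hCi.const_mul (2 * Real.pi ^ 2 * δ ^ 2)).mono' (hAc.aestronglyMeasurable.sub hBi.1)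
      (Eventually.of_forall fun k => hAB k)
  have hAi : Integrable A := (hABi.add hBi).congr (Eventually.of_forall fun k => by simp)
  have hAint : ∫ k, A k = δ ^ 2 / 2 * ∫ k : E2, 2 * Real.pi * ‖k‖ * ‖W k‖ ^ 2 := by
    rw [← integral_const_mul]
    refine integral_congr_ae (Eventually.of_forall fun k => ?_)
    simp only [hA, hF0, norm_mul, Complex.norm_real, Real.norm_of_nonneg hδ.le]
    ring
  refine ⟨?_, ?_⟩
  · rw [memLp_two_iff_integrable_sq_norm (Continuous.aestronglyMeasurable (by fun_prop))]
    refine (hCi.const_mul (4 * Real.pi ^ 2 * δ⁻¹)).mono'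
      (Continuous.aestronglyMeasurable (by fun_prop)) (Eventually.of_forall fun k => ?_)
    have h1 : ‖(δ : ℂ) * W k‖ ≤ ∫ z, ‖planarFourier u k z‖ := by
      rw [← hF0, Real.fourier_real_eq_integral_exp_smul]
      simpa using norm_integral_le_integral_norm (planarFourier u k)
    have h2 := sq_integral_norm_le (S := Set.Ioo 0 δ) (by simp) (integrable_planarFourier hu k)
      (memLp_planarFourier hu k) fun z hz => planarFourier_eq_zero hu k hz
    rw [← plancherel (integrable_planarFourier hu k) (memLp_planarFourier hu k)] at h2
    simp only [fourier_planarFourier hu, ← hU, Real.volume_real_Ioo_of_le hδ.le, sub_zero] at h2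
    have h3 : (δ * ‖W k‖) ^ 2 ≤ δ * ∫ s, ‖U (atHeight k s)‖ ^ 2 := by
      refine le_trans ?_ h2
      rw [norm_mul, Complex.norm_real, Real.norm_of_nonneg hδ.le] at h1
      gcongr
    rw [hC_eq, norm_pow, norm_norm, norm_mul, Complex.norm_real, Real.norm_of_nonneg (by positivity)]
    calc (2 * Real.pi * ‖k‖ * ‖W k‖) ^ 2
        = 4 * Real.pi ^ 2 * ‖k‖ ^ 2 * (δ ^ 2)⁻¹ * (δ * ‖W k‖) ^ 2 := by
          field_simp; ring
      _ ≤ 4 * Real.pi ^ 2 * ‖k‖ ^ 2 * (δ ^ 2)⁻¹ * (δ * ∫ s, ‖U (atHeight k s)‖ ^ 2) := by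
          gcongr
      _ = _ := by field_simp
  · have : (∫ ξ : E3, ‖U ξ‖ ^ 2 * (ξ 2 ^ 2 / ‖ξ‖ ^ 2)) - (∫ p, u p ^ 2)
        + δ ^ 2 / 2 * ∫ k : E2, 2 * Real.pi * ‖k‖ * ‖W k‖ ^ 2 = ∫ k, (A k - B k) := by
      rw [hE, ← hAint, integral_sub hAi hBi, hBint]
      ring
    rw [this, ← hCint, ← Real.norm_eq_abs]
    calc ‖∫ k, (A k - B k)‖ ≤ ∫ k, 2 * Real.pi ^ 2 * δ ^ 2 * C k :=
          norm_integral_le_of_norm_le (hCi.const_mul _) (Eventually.of_forall fun k => hAB k)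
      _ = _ := by rw [integral_const_mul]; ring

end FilmFourier

/-! ### Mollifying a Lipschitz function -/

section Mollify

open Filter Topology
open scoped Convolution NNReal

/-- The derivative of a mollified Lipschitz function is the mollified derivative. -/
lemma fderiv_convolution_lipschitz {χ : E2 → ℝ} {L : ℝ≥0} (hL : LipschitzWith L χ)
    {ρ : E2 → ℝ} (hρ : ContDiff ℝ (⊤ : ℕ∞) ρ) (hρc : HasCompactSupport ρ) (r v : E2) :
    fderiv ℝ (ρ ⋆[ContinuousLinearMap.lsmul ℝ ℝ] χ) r v
      = (ρ ⋆[ContinuousLinearMap.lsmul ℝ ℝ] fun x => lineDeriv ℝ χ x v) r := by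
  have hsm : ContDiff ℝ (⊤ : ℕ∞) (ρ ⋆[ContinuousLinearMap.lsmul ℝ ℝ] χ) :=
    hρc.contDiff_convolution_left _ hρ hL.continuous.locallyIntegrable
  have hd : HasLineDerivAt ℝ (ρ ⋆[ContinuousLinearMap.lsmul ℝ ℝ] χ)
      (fderiv ℝ (ρ ⋆[ContinuousLinearMap.lsmul ℝ ℝ] χ) r v) r v :=
    ((hsm.differentiable (by simp)).differentiableAt.hasFDerivAt).hasLineDerivAt v
  have ht := (hasDerivAt_iff_tendsto_slope_zero.1 hd).mono_left
    (nhdsWithin_mono (0 : ℝ) (s := Set.Ioi 0) fun t (ht : 0 < t) => ht.ne')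
  have hgi : Integrable (fun x => ρ (r - x)) :=
    (hρ.continuous.integrable_of_hasCompactSupport hρc).comp_sub_left r
  have ht2 := hL.integral_inv_smul_sub_mul_tendsto_integral_lineDeriv_mul (μ := volume) hgi v
  have e1 : (ρ ⋆[ContinuousLinearMap.lsmul ℝ ℝ] fun x => lineDeriv ℝ χ x v) r
      = ∫ x, lineDeriv ℝ χ x v * ρ (r - x) := by
    rw [convolution_eq_swap]
    simp [mul_comm]
  rw [e1]
  refine tendsto_nhds_unique ht (ht2.congr' ?_)
  filter_upwards [self_mem_nhdsWithin] with t ht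
  have hi : ∀ w : E2, Integrable (fun x => χ (x + w) * ρ (r - x)) := fun w => by
    refine Continuous.integrable_of_hasCompactSupport ?_ ?_
    · have := hL.continuous; have := hρ.continuous; fun_prop
    · exact (hρc.comp_homeomorph (Homeomorph.subLeft r)).mul_left
  have e2 : ∀ w : E2, (ρ ⋆[ContinuousLinearMap.lsmul ℝ ℝ] χ) (r + w)
      = ∫ x, χ (x + w) * ρ (r - x) := fun w => by
    rw [convolution_eq_swap, ← integral_add_right_eq_self _ w]
    refine integral_congr_ae (Eventually.of_forall fun x => ?_)
    simp [mul_comm]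
  have e3 := e2 0
  simp only [add_zero] at e3
  simp only [zero_smul, add_zero, zero_add]
  rw [e2, e3, ← integral_sub (hi _) (by simpa using hi 0), smul_eq_mul, ← integral_const_mul]
  refine integral_congr_ae (Eventually.of_forall fun x => ?_)
  simp only [smul_eq_mul]
  rw [← sub_mul, mul_assoc]

/-- Smooth approximations of a Lipschitz function: they vanish where the function vanishes in an
`ε`-neighbourhood, and their derivatives are bounded and converge almost everywhere. -/
lemma exists_smooth_approx {χ : E2 → ℝ} {L : ℝ≥0} (hL : LipschitzWith L χ) {ε : ℝ} (hε : 0 < ε) :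
    ∃ X : ℕ → E2 → ℝ, (∀ n, ContDiff ℝ (⊤ : ℕ∞) (X n)) ∧
      (∀ n r, (∀ x ∈ Metric.ball r ε, χ x = 0) → X n r = 0) ∧
      (∀ n r, |X n r - χ r| ≤ L * ε) ∧
      (∀ r, Tendsto (fun n => X n r) atTop (𝓝 (χ r))) ∧
      (∀ n r v, |fderiv ℝ (X n) r v| ≤ L * ‖v‖) ∧
      ∀ v, ∀ᵐ r, Tendsto (fun n => fderiv ℝ (X n) r v) atTop (𝓝 (lineDeriv ℝ χ r v)) := by
  -- The two radii have a bounded ratio, as Lebesgue differentiation requires.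
  let φ : ℕ → ContDiffBump (0 : E2) := fun n =>
    ⟨ε / (2 * ((n : ℝ) + 1)), ε / ((n : ℝ) + 1), by positivity, by
      apply div_lt_div_of_pos_left hε (by positivity); linarith [n.cast_nonneg (α := ℝ)]⟩
  have hrout : ∀ n, (φ n).rOut ≤ ε := fun n =>
    div_le_self hε.le (by linarith [n.cast_nonneg (α := ℝ)])
  have hlim : Tendsto (fun n => (φ n).rOut) atTop (𝓝 0) :=
    tendsto_const_nhds.div_atTop (tendsto_natCast_atTop_atTop.atTop_add tendsto_const_nhds)
  have hballs : ∀ n r, Metric.ball (r : E2) (φ n).rOut ⊆ Metric.ball r ε := fun n r =>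
    Metric.ball_subset_ball (hrout n)
  have hf : ∀ n r v, fderiv ℝ ((φ n).normed volume ⋆[ContinuousLinearMap.lsmul ℝ ℝ] χ) r v
      = ((φ n).normed volume ⋆[ContinuousLinearMap.lsmul ℝ ℝ] fun x => lineDeriv ℝ χ x v) r :=
    fun n r v => fderiv_convolution_lipschitz hL (φ n).contDiff_normed
      (φ n).hasCompactSupport_normed r v
  have hm : ∀ v, Measurable (fun x => lineDeriv ℝ χ x v) := fun v =>
    measurable_lineDeriv hL.continuous
  have hb : ∀ v x, ‖lineDeriv ℝ χ x v‖ ≤ L * ‖v‖ := fun v x => norm_lineDeriv_le_of_lipschitz ℝ hL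
  refine ⟨fun n => (φ n).normed volume ⋆[ContinuousLinearMap.lsmul ℝ ℝ] χ, fun n => ?_,
    fun n r h => ?_, fun n r => ?_, fun r => ?_, fun n r v => ?_, fun v => ?_⟩
  · exact (φ n).hasCompactSupport_normed.contDiff_convolution_left _ (φ n).contDiff_normed
      hL.continuous.locallyIntegrable
  · have hr := h r (Metric.mem_ball_self hε)
    refine (ContDiffBump.normed_convolution_eq_right ?_).trans hr
    intro x hx
    rw [hr, h x (hballs n r hx)]
  · rw [← Real.dist_eq]
    refine ContDiffBump.dist_normed_convolution_le hL.continuous.aestronglyMeasurable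
      fun x hx => ?_
    refine (hL.dist_le_mul x r).trans ?_
    gcongr
    exact (Metric.mem_ball.1 (hballs n r hx)).le
  · exact ContDiffBump.convolution_tendsto_right_of_continuous hlim hL.continuous r
  · rw [hf, convolution_def, ← Real.norm_eq_abs]
    calc _ ≤ ∫ t, (φ n).normed volume t * (L * ‖v‖) := by
          refine norm_integral_le_of_norm_le ((φ n).integrable_normed.mul_const _)
            (Eventually.of_forall fun t => ?_)
          rw [ContinuousLinearMap.lsmul_apply, norm_smul,
            Real.norm_of_nonneg ((φ n).nonneg_normed t)]
          gcongr
          · exact (φ n).nonneg_normed t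
          · exact hb v _
      _ = L * ‖v‖ := by rw [integral_mul_const, (φ n).integral_normed, one_mul]
  · simp only [hf]
    refine ContDiffBump.ae_convolution_tendsto_right_of_locallyIntegrable (K := 2) hlim
      (Eventually.of_forall fun n => ?_) ?_
    · change ε / ((n : ℝ) + 1) ≤ 2 * (ε / (2 * ((n : ℝ) + 1)))
      apply le_of_eq
      field_simp
    · refine (locallyIntegrable_const (L * ‖v‖ : ℝ)).mono (hm v).aestronglyMeasurable
        (Eventually.of_forall fun x => ?_)
      exact (hb v x).trans (le_abs_self _)

end Mollify

/-! ### Cutoffs in the plane and in height -/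

section Cutoff

open Filter Topology
open scoped NNReal

variable {δ : ℝ} {η : ℝ → ℝ} {D : Set E2} {Ω : Set E3}

lemma IsCutoffProfile.norm_deriv_le (hη : IsCutoffProfile η) (t : ℝ) : ‖deriv η t‖ ≤ 2 := by
  rw [Real.norm_of_nonneg (hη.deriv_mem t).1]
  exact (hη.deriv_mem t).2

lemma exists_lipschitz_cutoff (hη : IsCutoffProfile η) (δ : ℝ) (D : Set E2) :
    ∃ L : ℝ≥0, LipschitzWith L (cutoff η δ D) := by
  have h1 : LipschitzWith 2 η := lipschitzWith_of_nnnorm_deriv_le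
    (hη.smooth.differentiable (by simp)) fun t => by exact_mod_cast hη.norm_deriv_le t
  have h2 : LipschitzWith (‖δ⁻¹‖₊ * 1) fun r : E2 => δ⁻¹ * Metric.infDist r Dᶜ :=
    (lipschitzWith_smul δ⁻¹).comp (Metric.lipschitz_infDist_pt Dᶜ)
  exact ⟨_, h1.comp h2⟩

lemma cutoff_eq_zero (hη : IsCutoffProfile η) (hδ : 0 < δ) {r : E2}
    (hr : Metric.infDist r Dᶜ ≤ δ) : cutoff η δ D r = 0 := by
  apply hη.eq_zero
  rw [inv_mul_le_iff₀ hδ]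
  simpa using hr

/-- The points of `D` at distance at least `ε` from its complement. -/
def innerPart (ε : ℝ) (D : Set E2) : Set E2 := {r | ε ≤ Metric.infDist r Dᶜ}

lemma isClosed_innerPart (ε : ℝ) (D : Set E2) : IsClosed (innerPart ε D) :=
  isClosed_le continuous_const (Metric.continuous_infDist_pt _)

lemma innerPart_subset {ε : ℝ} (hε : 0 < ε) (D : Set E2) : innerPart ε D ⊆ D := by
  intro r hr
  by_contra h
  have : Metric.infDist r Dᶜ = 0 := Metric.infDist_zero_of_mem h
  have hr' : ε ≤ Metric.infDist r Dᶜ := hr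
  linarith

lemma cutoff_eq_zero_of_notMem (hη : IsCutoffProfile η) (hδ : 0 < δ) {r : E2} (hr : r ∉ D) :
    cutoff η δ D r = 0 :=
  cutoff_eq_zero hη hδ (by rw [Metric.infDist_zero_of_mem (show r ∈ Dᶜ from hr)]; exact hδ.le)

lemma cutoff_eq_zero_near (hη : IsCutoffProfile η) (hδ : 0 < δ) {r : E2}
    (hr : r ∉ innerPart (δ / 2) D) : ∀ x ∈ Metric.ball r (δ / 2), cutoff η δ D x = 0 := by
  intro x hx
  apply cutoff_eq_zero hη hδ
  have h1 : Metric.infDist r Dᶜ < δ / 2 := not_le.1 hr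
  have h2 : Metric.infDist x Dᶜ ≤ Metric.infDist r Dᶜ + dist x r := Metric.infDist_le_infDist_add_dist
  have h3 := Metric.mem_ball.1 hx
  linarith

lemma abs_cutoff_le_one (hη : IsCutoffProfile η) (r : E2) : |cutoff η δ D r| ≤ 1 :=
  abs_le.2 ⟨le_trans (by norm_num) (hη.mem_unit _).1, (hη.mem_unit _).2⟩

lemma IsCutoffProfile.deriv_eq_zero (hη : IsCutoffProfile η) {t : ℝ} (ht : 2 < t) :
    deriv η t = 0 := by
  have : η =ᶠ[𝓝 t] fun _ => 1 := by
    filter_upwards [lt_mem_nhds ht] with s hs using hη.eq_one s hs.le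
  rw [this.deriv_eq]
  simp

/-- Smooth cutoffs of the interval `(0, δ)`, equal to `1` at distance at least `2 / m` from its
ends. -/
def heightCutoff (η : ℝ → ℝ) (δ m : ℝ) (z : ℝ) : ℝ := η (m * z) * η (m * (δ - z))

lemma contDiff_heightCutoff (hη : IsCutoffProfile η) (δ m : ℝ) :
    ContDiff ℝ (⊤ : ℕ∞) (heightCutoff η δ m) := by
  have := hη.smooth
  unfold heightCutoff
  fun_prop

lemma abs_heightCutoff_le_one (hη : IsCutoffProfile η) (δ m z : ℝ) :
    |heightCutoff η δ m z| ≤ 1 := by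
  have h1 := hη.mem_unit (m * z)
  have h2 := hη.mem_unit (m * (δ - z))
  rw [heightCutoff, abs_of_nonneg (mul_nonneg h1.1 h2.1)]
  exact mul_le_one₀ h1.2 h2.1 h2.2

lemma heightCutoff_eq_zero (hη : IsCutoffProfile η) {δ m z : ℝ} (hm : 0 < m)
    (hz : z ∉ Set.Icc m⁻¹ (δ - m⁻¹)) : heightCutoff η δ m z = 0 := by
  rw [heightCutoff]
  rcases not_and_or.1 hz with h | h
  · rw [hη.eq_zero (m * z), zero_mul]
    rw [← mul_inv_cancel₀ hm.ne']
    gcongr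
    exact (not_le.1 h).le
  · rw [hη.eq_zero (m * (δ - z)), mul_zero]
    rw [← mul_inv_cancel₀ hm.ne']
    gcongr
    linarith [not_le.1 h]

lemma deriv_heightCutoff (hη : IsCutoffProfile η) (δ m z : ℝ) :
    deriv (heightCutoff η δ m) z
      = m * deriv η (m * z) * η (m * (δ - z)) - η (m * z) * (m * deriv η (m * (δ - z))) := by
  have hd : Differentiable ℝ η := hη.smooth.differentiable (by simp)
  have h1 : HasDerivAt (fun z => η (m * z)) (deriv η (m * z) * m) z :=
    (hd _).hasDerivAt.comp z (by simpa using (hasDerivAt_id z).const_mul m)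
  have h2 : HasDerivAt (fun z => η (m * (δ - z))) (deriv η (m * (δ - z)) * (-m)) z :=
    (hd _).hasDerivAt.comp z (by simpa using ((hasDerivAt_id z).const_sub δ).const_mul m)
  have := (h1.mul h2).deriv
  rw [show heightCutoff η δ m = (fun z => η (m * z)) * fun z => η (m * (δ - z)) from rfl, this]
  ring

/-- The derivative of the cutoff is of order `m`, but lives within `2 / m` of the ends. -/
lemma abs_deriv_heightCutoff_mul_le (hη : IsCutoffProfile η) {δ m z : ℝ} (hm : 0 < m)
    (hz : z ∈ Set.Ioo 0 δ) :
    |deriv (heightCutoff η δ m) z| * min z (δ - z) ≤ 8 := by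
  have hz0 := hz.1
  have hzδ : 0 < δ - z := by linarith [hz.2]
  have key : ∀ t, 0 < t → |deriv η (m * t)| * (m * t) ≤ 4 := by
    intro t ht
    by_cases h : m * t ≤ 2
    · have := hη.norm_deriv_le (m * t)
      rw [Real.norm_eq_abs] at this
      calc _ ≤ 2 * 2 := mul_le_mul this h (by positivity) (by norm_num)
        _ = 4 := by norm_num
    · rw [hη.deriv_eq_zero (not_le.1 h)]; simp
  have ab : ∀ t, |η t| ≤ 1 := fun t => by
    rw [abs_of_nonneg (hη.mem_unit t).1]; exact (hη.mem_unit t).2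
  rw [deriv_heightCutoff hη]
  have hmin : 0 ≤ min z (δ - z) := le_min hz0.le hzδ.le
  calc _ ≤ (|m * deriv η (m * z) * η (m * (δ - z))| + |η (m * z) * (m * deriv η (m * (δ - z)))|)
        * min z (δ - z) := by
        gcongr; exact abs_sub _ _
    _ ≤ (m * |deriv η (m * z)| * 1) * z + (1 * (m * |deriv η (m * (δ - z))|)) * (δ - z) := by
        rw [add_mul]
        simp only [abs_mul, abs_of_pos hm]
        gcongr
        · exact ab _
        · exact min_le_left _ _
        · exact ab _
        · exact min_le_right _ _
    _ ≤ 4 + 4 := by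
        refine add_le_add ?_ ?_
        · refine le_trans (le_of_eq ?_) (key z hz0); ring
        · refine le_trans (le_of_eq ?_) (key (δ - z) hzδ); ring
    _ = 8 := by norm_num

lemma eventually_heightCutoff (hη : IsCutoffProfile η) {δ z : ℝ} (hz : z ∈ Set.Ioo 0 δ) :
    ∀ᶠ m : ℝ in atTop, heightCutoff η δ m z = 1 ∧ deriv (heightCutoff η δ m) z = 0 := by
  have hzδ : 0 < δ - z := by linarith [hz.2]
  filter_upwards [(tendsto_id.atTop_mul_const hz.1).eventually_gt_atTop 2,
    (tendsto_id.atTop_mul_const hzδ).eventually_gt_atTop 2] with m h1 h2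
  simp only [id] at h1 h2
  rw [deriv_heightCutoff hη, heightCutoff, hη.eq_one _ h1.le, hη.eq_one _ h2.le,
    hη.deriv_eq_zero h1, hη.deriv_eq_zero h2]
  simp

end Cutoff

/-! ### Integration by parts in the film -/

section WeakGradient

open Filter Topology
open scoped NNReal

variable {δ : ℝ} {η : ℝ → ℝ} {D : Set E2} {Ω : Set E3} {φ : E3 → ℝ} {G₀ : E3 → E3}

/-- The projection of `ℝ³` onto the plane, as a continuous linear map. -/
noncomputable def planarL : E3 →L[ℝ] E2 :=
  LinearMap.toContinuousLinearMap
    { toFun := planar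
      map_add' := fun p q => by ext i; fin_cases i <;> simp [planar]
      map_smul' := fun c p => by ext i; fin_cases i <;> simp [planar] }

@[simp] lemma planarL_apply (p : E3) : planarL p = planar p := rfl

lemma contDiff_planar : ContDiff ℝ (⊤ : ℕ∞) planar := planarL.contDiff

lemma contDiff_atHeight (c : ℝ) : ContDiff ℝ (⊤ : ℕ∞) fun p : E3 => atHeight (planar p) c := by
  have := contDiff_planar
  rw [contDiff_euclidean]
  intro i
  fin_cases i <;> simp [atHeight, planar] <;> fun_prop

lemma norm_planar_single_le (i : Fin 3) : ‖planar (EuclideanSpace.single i (1 : ℝ))‖ ≤ 1 :=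
  (norm_planar_le _).trans (by simp)

lemma quasiMeasurePreserving_planar : Measure.QuasiMeasurePreserving planar volume volume :=
  Measure.quasiMeasurePreserving_fst.comp
    measurePreserving_sliceEquiv.quasiMeasurePreserving

lemma IsFilm.exists_radius (hΩ : IsFilm δ D Ω) : ∃ R, Ω ⊆ slabSet δ R := by
  obtain ⟨R, hR⟩ := (hΩ.isBounded_section.thickening (δ := δ)).subset_ball 0
  exact ⟨R, fun p hp => ⟨hR (hΩ.film_subset hp).1, (hΩ.film_subset hp).2⟩⟩

lemma isBounded_slabSet (δ R : ℝ) : Bornology.IsBounded (slabSet δ R) := by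
  refine (Metric.isBounded_iff_subset_closedBall 0).2 ⟨|R| + |δ|, fun p hp => ?_⟩
  rw [mem_closedBall_zero_iff]
  have h1 : ‖planar p‖ ≤ |R| := (mem_ball_zero_iff.1 hp.1).le.trans (le_abs_self R)
  have h2 : |p 2| ≤ |δ| := by
    rw [abs_of_pos hp.2.1]; exact hp.2.2.le.trans (le_abs_self δ)
  refine abs_le_of_sq_le_sq' ?_ (by positivity) |>.2
  rw [norm_sq_eq_planar_add, ← sq_abs (p 2)]
  nlinarith [norm_nonneg (planar p), abs_nonneg (p 2), abs_nonneg R, abs_nonneg δ]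

lemma IsFilm.volume_lt_top (hΩ : IsFilm δ D Ω) : volume Ω < ∞ := by
  obtain ⟨R, hR⟩ := hΩ.exists_radius
  exact (measure_mono hR).trans_lt (volume_slabSet_lt_top δ R)

/-- The gradient of the cutoff, as a field on `ℝ³`. The cutoff is Lipschitz, so its line
derivatives exist almost everywhere; elsewhere `lineDeriv` is `0`. -/
noncomputable def cutoffGrad (η : ℝ → ℝ) (δ : ℝ) (D : Set E2) (p : E3) : E3 :=
  WithLp.toLp 2 fun i => lineDeriv ℝ (cutoff η δ D) (planar p) (planar (EuclideanSpace.single i 1))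

/-- The weak gradient `χ ∇φ + φ ∇χ` of `χ φ`. -/
noncomputable def cutGrad (η : ℝ → ℝ) (δ : ℝ) (D : Set E2) (φ : E3 → ℝ) (G₀ : E3 → E3)
    (p : E3) : E3 :=
  cutoff η δ D (planar p) • G₀ p + φ p • cutoffGrad η δ D p

lemma measurable_cutoffGrad (hη : IsCutoffProfile η) (δ : ℝ) (D : Set E2) :
    Measurable (cutoffGrad η δ D) := by
  obtain ⟨L, hL⟩ := exists_lipschitz_cutoff hη δ D
  refine (WithLp.measurable_toLp 2 _).comp (measurable_pi_lambda _ fun i => ?_)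
  exact (measurable_lineDeriv hL.continuous).comp continuous_planar.measurable

lemma continuous_cutoff (hη : IsCutoffProfile η) (δ : ℝ) (D : Set E2) :
    Continuous (cutoff η δ D) := by
  obtain ⟨L, hL⟩ := exists_lipschitz_cutoff hη δ D
  exact hL.continuous

lemma exists_norm_cutoffGrad_le (hη : IsCutoffProfile η) (δ : ℝ) (D : Set E2) :
    ∃ C, ∀ p, ‖cutoffGrad η δ D p‖ ≤ C := by
  obtain ⟨L, hL⟩ := exists_lipschitz_cutoff hη δ D
  refine ⟨√(3 * (L : ℝ) ^ 2), fun p => ?_⟩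
  rw [EuclideanSpace.norm_eq]
  refine Real.sqrt_le_sqrt ?_
  have : ∀ i, ‖cutoffGrad η δ D p i‖ ^ 2 ≤ (L : ℝ) ^ 2 := fun i => by
    gcongr
    refine (norm_lineDeriv_le_of_lipschitz ℝ hL).trans ?_
    exact mul_le_of_le_one_right L.2 (norm_planar_single_le i)
  calc _ ≤ ∑ _i : Fin 3, (L : ℝ) ^ 2 := Finset.sum_le_sum fun i _ => this i
    _ = _ := by simp

lemma memLp_cutGrad (hη : IsCutoffProfile η)
    (hφ : MemLp φ 2 (volume.restrict Ω)) (hG₀ : MemLp G₀ 2 (volume.restrict Ω)) :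
    MemLp (cutGrad η δ D φ G₀) 2 (volume.restrict Ω) := by
  obtain ⟨C, hC⟩ := exists_norm_cutoffGrad_le hη δ D
  have hc := (continuous_cutoff hη δ D).comp continuous_planar
  have hC0 : 0 ≤ C := (norm_nonneg _).trans (hC 0)
  refine MemLp.add (MemLp.of_le hG₀ (hc.aestronglyMeasurable.smul hG₀.1)
    (Eventually.of_forall fun p => ?_)) (MemLp.of_le_mul (c := C) hφ
    (hφ.1.smul (measurable_cutoffGrad hη δ D).aestronglyMeasurable)
    (Eventually.of_forall fun p => ?_))
  · rw [norm_smul]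
    exact mul_le_of_le_one_left (norm_nonneg _) (abs_cutoff_le_one hη _)
  · rw [norm_smul, mul_comm]
    gcongr
    exact hC p

lemma partialDeriv_eq {ψ : E3 → ℝ} {L : E3 →L[ℝ] ℝ} {p : E3} (h : HasFDerivAt ψ L p) (i : Fin 3) :
    partialDeriv i ψ p = L (EuclideanSpace.single i 1) := by
  rw [partialDeriv, h.fderiv]

lemma hasFDerivAt_height {θ : ℝ → ℝ} {p : E3} (hθ : DifferentiableAt ℝ θ (p 2)) :
    HasFDerivAt (fun p : E3 => θ (p 2)) (deriv θ (p 2) • EuclideanSpace.proj (𝕜 := ℝ) (2 : Fin 3)) p :=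
  hθ.hasDerivAt.comp_hasFDerivAt p (EuclideanSpace.proj (𝕜 := ℝ) (2 : Fin 3)).hasFDerivAt

lemma hasDerivAt_comp_atHeight {ζ : E3 → ℝ} (hζ : ContDiff ℝ (⊤ : ℕ∞) ζ) (r : E2) (z : ℝ) :
    HasDerivAt (fun z => ζ (atHeight r z)) (partialDeriv 2 ζ (atHeight r z)) z := by
  have h1 : HasDerivAt (fun z => atHeight r z) (EuclideanSpace.single 2 (1 : ℝ)) z := by
    have e : (fun z => atHeight r z)
        = fun z : ℝ => atHeight r 0 + z • EuclideanSpace.single (2 : Fin 3) (1 : ℝ) := by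
      ext z i; fin_cases i <;> simp [atHeight]
    rw [e]
    simpa using ((hasDerivAt_id z).smul_const
      (EuclideanSpace.single (2 : Fin 3) (1 : ℝ))).const_add (atHeight r 0)
  exact ((hζ.differentiable (by simp)).differentiableAt.hasFDerivAt).comp_hasDerivAt z h1

lemma continuous_partialDeriv {ζ : E3 → ℝ} (hζ : ContDiff ℝ (⊤ : ℕ∞) ζ) (i : Fin 3) :
    Continuous (partialDeriv i ζ) :=
  (hζ.continuous_fderiv (by simp)).clm_apply continuous_const

/-- A function vanishing on top and bottom is small near them. -/
lemma abs_le_mul_min_of_vanish {ζ : E3 → ℝ} (hζ : ContDiff ℝ (⊤ : ℕ∞) ζ) {M : ℝ} {r : E2}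
    (hM : ∀ z ∈ Set.Icc 0 δ, |partialDeriv 2 ζ (atHeight r z)| ≤ M)
    (h0 : ζ (atHeight r 0) = 0) (h1 : ζ (atHeight r δ) = 0) {z : ℝ} (hz : z ∈ Set.Icc 0 δ) :
    |ζ (atHeight r z)| ≤ M * min z (δ - z) := by
  have hδ : 0 ≤ δ := hz.1.trans hz.2
  have key := fun x hx y hy => (convex_Icc 0 δ).norm_image_sub_le_of_norm_hasDerivWithin_le
    (f := fun z => ζ (atHeight r z)) (x := x) (y := y)
    (fun x _ => (hasDerivAt_comp_atHeight hζ r x).hasDerivWithinAt) hM hx hy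
  have k0 := key 0 ⟨le_rfl, hδ⟩ z hz
  have k1 := key δ ⟨hδ, le_rfl⟩ z hz
  simp only [h0, h1, sub_zero, Real.norm_eq_abs] at k0 k1
  rw [abs_of_nonneg hz.1] at k0
  rw [abs_sub_comm z δ, abs_of_nonneg (sub_nonneg.2 hz.2)] at k1
  rcases le_total z (δ - z) with h | h
  · rwa [min_eq_left h]
  · rwa [min_eq_right h]

/-- Integration by parts for `χ φ` against functions that need not have compact support in `Ω`:
they need not vanish near the lateral boundary, which is beyond the cutoff, and for the in-plane
derivatives they need not vanish at the top and the bottom either. -/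
theorem integral_cutField_mul_partialDeriv (hδ : 0 < δ) (hη : IsCutoffProfile η)
    (hΩ : IsFilm δ D Ω) (hφ : MemLp φ 2 (volume.restrict Ω)) (hG₀ : MemLp G₀ 2 (volume.restrict Ω))
    (hw : IsWeakGradient Ω φ G₀) {ζ : E3 → ℝ} (hζ : ContDiff ℝ (⊤ : ℕ∞) ζ) (i : Fin 3)
    (hi : i = 2 → ∀ r, ζ (atHeight r 0) = 0 ∧ ζ (atHeight r δ) = 0) :
    ∫ p in Ω, cutField η δ D Ω φ p * partialDeriv i ζ p
      = - ∫ p in Ω, cutGrad η δ D φ G₀ p i * ζ p := by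
  obtain ⟨L, hL⟩ := exists_lipschitz_cutoff hη δ D
  obtain ⟨X, hXs, hX0, hXb, hXt, hXd, hXdt⟩ := exists_smooth_approx hL (half_pos hδ)
  set χ := cutoff η δ D with hχ
  set K := innerPart (δ / 2) D with hK
  have hKc : IsCompact K := Metric.isCompact_of_isClosed_isBounded (isClosed_innerPart _ _)
    (hΩ.isBounded_section.subset (innerPart_subset (half_pos hδ) D))
  have hX0' : ∀ n r, r ∉ K → X n r = 0 := fun n r hr => hX0 n r (cutoff_eq_zero_near hη hδ hr)
  have hχ0 : ∀ r, r ∉ K → χ r = 0 := fun r hr =>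
    cutoff_eq_zero_near hη hδ hr r (Metric.mem_ball_self (half_pos hδ))
  have hdX0 : ∀ n r v, r ∉ K → fderiv ℝ (X n) r v = 0 := fun n r v hr => by
    have : X n =ᶠ[𝓝 r] fun _ => 0 := by
      filter_upwards [(isClosed_innerPart (δ / 2) D).isOpen_compl.mem_nhds hr] with x hx
      exact hX0' n x hx
    rw [this.fderiv_eq]
    simp
  have hdχ0 : ∀ r v, r ∉ K → lineDeriv ℝ χ r v = 0 := fun r v hr => by
    have : χ =ᶠ[𝓝 r] fun _ => 0 := by
      filter_upwards [(isClosed_innerPart (δ / 2) D).isOpen_compl.mem_nhds hr] with x hx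
      exact hχ0 x hx
    rw [this.lineDeriv_eq, lineDeriv]
    simp
  have hXb' : ∀ n r, |X n r| ≤ 1 + L * (δ / 2) := fun n r => by
    have h1 := hXb n r
    have h2 := abs_cutoff_le_one (δ := δ) (D := D) hη r
    calc |X n r| = |χ r + (X n r - χ r)| := by rw [add_sub_cancel]
      _ ≤ |χ r| + |X n r - χ r| := abs_add_le _ _
      _ ≤ _ := add_le_add h2 h1
  -- Bounds on the part of the closed slab above `K`.
  set box : Set E3 := (fun w : E2 × ℝ => atHeight w.1 w.2) '' (K ×ˢ Set.Icc 0 δ) with hbox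
  have hboxc : IsCompact box := (hKc.prod isCompact_Icc).image continuous_atHeight
  have hmem : ∀ p ∈ Ω, planar p ∈ K → p ∈ box := fun p hp hpK =>
    ⟨(planar p, p 2), ⟨hpK, Set.Ioo_subset_Icc_self (hΩ.film_subset hp).2⟩, atHeight_planar p⟩
  obtain ⟨M₁, hM₁⟩ := hboxc.exists_bound_of_continuousOn hζ.continuous.continuousOn
  obtain ⟨M₂, hM₂⟩ := hboxc.exists_bound_of_continuousOn (continuous_partialDeriv hζ i).continuousOn
  set M := max 0 (max M₁ M₂) with hM
  have hM0 : 0 ≤ M := le_max_left _ _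
  have hMζ : ∀ p ∈ box, |ζ p| ≤ M := fun p hp =>
    (hM₁ p hp).trans ((le_max_left _ _).trans (le_max_right _ _))
  have hMd : ∀ p ∈ box, |partialDeriv i ζ p| ≤ M := fun p hp =>
    (hM₂ p hp).trans ((le_max_right _ _).trans (le_max_right _ _))
  set e : E3 := EuclideanSpace.single i 1 with he
  set θ : ℕ → ℝ → ℝ := fun n => heightCutoff η δ ((n : ℝ) + 1) with hθ
  have hmpos : ∀ n : ℕ, (0 : ℝ) < n + 1 := fun n => by positivity
  -- `ψ n` is an admissible test function for `φ`, and converges to `χ ζ`; its derivatives `dψ n`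
  -- stay bounded where `θ n` varies, because `ζ` is small there if `i = 2`.
  set ψ : ℕ → E3 → ℝ := fun n p => X n (planar p) * θ n (p 2) * ζ p with hψ
  set dψ : ℕ → E3 → ℝ := fun n p => X n (planar p) * θ n (p 2) * partialDeriv i ζ p
    + (X n (planar p) * (deriv (θ n) (p 2) * e 2) + fderiv ℝ (X n) (planar p) (planar e) * θ n (p 2))
      * ζ p with hdψ
  have hψd : ∀ n p, partialDeriv i (ψ n) p = dψ n p := by
    intro n p
    have a1 : HasFDerivAt (fun p => X n (planar p)) ((fderiv ℝ (X n) (planar p)).comp planarL) p :=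
      ((hXs n).differentiable (by simp)).differentiableAt.hasFDerivAt.comp p planarL.hasFDerivAt
    have a2 := hasFDerivAt_height (θ := θ n) (p := p)
      ((contDiff_heightCutoff hη δ _).differentiable (by simp)).differentiableAt
    have a3 : HasFDerivAt ζ (fderiv ℝ ζ p) p :=
      (hζ.differentiable (by simp)).differentiableAt.hasFDerivAt
    refine (partialDeriv_eq ((a1.mul a2).mul a3) i).trans ?_
    simp only [hdψ, partialDeriv, ← he, add_apply, smul_apply,
      ContinuousLinearMap.comp_apply, planarL_apply, PiLp.proj_apply, Pi.mul_apply, smul_eq_mul]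
    ring
  have htest : ∀ n, IsTestFunction Ω (ψ n) := by
    intro n
    set B : Set E3 := (fun w : E2 × ℝ => atHeight w.1 w.2) ''
      (K ×ˢ Set.Icc ((n : ℝ) + 1)⁻¹ (δ - ((n : ℝ) + 1)⁻¹)) with hB
    have hBc : IsCompact B := (hKc.prod isCompact_Icc).image continuous_atHeight
    have hz : ∀ p, p ∉ B → ψ n p = 0 := by
      intro p hp
      by_cases h1 : planar p ∈ K
      · have h2 : p 2 ∉ Set.Icc ((n : ℝ) + 1)⁻¹ (δ - ((n : ℝ) + 1)⁻¹) := fun h2 =>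
          hp ⟨(planar p, p 2), ⟨h1, h2⟩, atHeight_planar p⟩
        simp only [hψ, hθ, heightCutoff_eq_zero hη (hmpos n) h2, mul_zero, zero_mul]
      · simp only [hψ, hX0' n _ h1, zero_mul]
    refine ⟨?_, HasCompactSupport.intro hBc hz, ?_⟩
    · have h1 := (hXs n).comp contDiff_planar
      have h2 : ContDiff ℝ (⊤ : ℕ∞) fun p : E3 => θ n (p 2) :=
        (contDiff_heightCutoff hη δ _).comp (EuclideanSpace.proj (𝕜 := ℝ) (2 : Fin 3)).contDiff
      exact (h1.mul h2).mul hζ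
    · have hsub : tsupport (ψ n) ⊆ B := closure_minimal (fun p hp => ?_) hBc.isClosed
      refine hsub.trans ?_
      rotate_left
      · by_contra h
        exact hp (hz p h)
      · rintro _ ⟨⟨r, z⟩, ⟨hr, hz⟩, rfl⟩
        refine hΩ.subset_film ⟨?_, ?_⟩
        · simpa using innerPart_subset (half_pos hδ) D hr
        · have : 0 < ((n : ℝ) + 1)⁻¹ := by positivity
          simp only [atHeight_two]
          exact ⟨this.trans_le hz.1, by linarith [hz.2]⟩
  have hweak : ∀ n, ∫ p in Ω, φ p * dψ n p = - ∫ p in Ω, G₀ p i * ψ n p := fun n => by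
    rw [← hw.2.2 (ψ n) (htest n) i]
    simp only [hψd]
  have : IsFiniteMeasure (volume.restrict Ω) := ⟨by simpa using hΩ.volume_lt_top⟩
  have hφ1 : IntegrableOn φ Ω := hφ.integrable (by norm_num)
  have hG1 : IntegrableOn (fun p => G₀ p i) Ω :=
    (EuclideanSpace.proj (𝕜 := ℝ) i).integrable_comp (hG₀.integrable (by norm_num))
  have hpl := continuous_planar
  have hζc := hζ.continuous
  have hdζc := continuous_partialDeriv hζ i
  have hχc : Continuous χ := hL.continuous
  have hXc : ∀ n, Continuous (X n) := fun n => (hXs n).continuous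
  have hθc : ∀ n, Continuous (θ n) := fun n => (contDiff_heightCutoff hη δ _).continuous
  have hdθc : ∀ n, Continuous (deriv (θ n)) := fun n =>
    (contDiff_heightCutoff hη δ _).continuous_deriv (by simp)
  have hdXc : ∀ n, Continuous fun r => fderiv ℝ (X n) r (planar e) := fun n =>
    ((hXs n).continuous_fderiv (by simp)).clm_apply continuous_const
  have hθb : ∀ n z, |θ n z| ≤ 1 := fun n z => abs_heightCutoff_le_one hη _ _ _
  have hev : ∀ p ∈ Ω, Tendsto (fun n => θ n (p 2)) atTop (𝓝 1) ∧
      Tendsto (fun n => deriv (θ n) (p 2)) atTop (𝓝 0) := by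
    intro p hp
    have hat : Tendsto (fun n : ℕ => (n : ℝ) + 1) atTop atTop :=
      tendsto_natCast_atTop_atTop.atTop_add tendsto_const_nhds
    have h := hat.eventually (eventually_heightCutoff hη (hΩ.film_subset hp).2)
    exact ⟨tendsto_const_nhds.congr' (h.mono fun n hn => hn.1.symm),
      tendsto_const_nhds.congr' (h.mono fun n hn => hn.2.symm)⟩
  have hdθζ : ∀ n, ∀ p ∈ Ω, planar p ∈ K → |deriv (θ n) (p 2) * e 2| * |ζ p| ≤ 8 * M := by
    intro n p hp hpK
    by_cases hi2 : i = 2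
    · subst hi2
      have hz := (hΩ.film_subset hp).2
      have hb := abs_le_mul_min_of_vanish hζ (r := planar p) (δ := δ) (M := M)
        (fun z hz => hMd _ ⟨(planar p, z), ⟨hpK, hz⟩, rfl⟩) (hi rfl _).1 (hi rfl _).2
        (Set.Ioo_subset_Icc_self hz)
      rw [atHeight_planar] at hb
      have h8 := abs_deriv_heightCutoff_mul_le hη (hmpos n) hz
      have he2 : e 2 = 1 := by simp [he]
      rw [he2, mul_one]
      calc _ ≤ |deriv (θ n) (p 2)| * (M * min (p 2) (δ - p 2)) := by gcongr
        _ = |deriv (θ n) (p 2)| * min (p 2) (δ - p 2) * M := by ring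
        _ ≤ 8 * M := by gcongr
    · have he2 : e 2 = 0 := by simp [he, Ne.symm hi2]
      rw [he2]
      simp [hM0]
  set C := 1 + (L : ℝ) * (δ / 2) with hC
  have hC0 : 0 ≤ C := by positivity
  have lim1 : Tendsto (fun n => ∫ p in Ω, φ p * dψ n p) atTop
      (𝓝 (∫ p in Ω, φ p * (χ (planar p) * partialDeriv i ζ p + cutoffGrad η δ D p i * ζ p))) := by
    refine tendsto_integral_of_dominated_convergence (fun p => ‖φ p‖ * (C * M + (C * (8 * M) + L * M)))
      (fun n => ?_) (hφ1.norm.mul_const _) (fun n => ?_) ?_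
    · refine hφ.1.mul (Continuous.aestronglyMeasurable ?_)
      have := hXc n; have := hθc n; have := hdθc n; have := (hdXc n).comp hpl
      simp only [hdψ]
      fun_prop
    · filter_upwards [ae_restrict_mem hΩ.isOpen_film.measurableSet] with p hp
      rw [norm_mul]
      gcongr
      by_cases hpK : planar p ∈ K
      · have b1 := hMζ p (hmem p hp hpK)
        have b2 := hMd p (hmem p hp hpK)
        have b3 := hdθζ n p hp hpK
        have b4 := hXb' n (planar p)
        have b5 := hθb n (p 2)
        have b6 : |fderiv ℝ (X n) (planar p) (planar e)| ≤ L := (hXd n _ _).trans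
          (mul_le_of_le_one_right L.2 (norm_planar_single_le i))
        rw [Real.norm_eq_abs]
        refine (abs_add_le _ _).trans (add_le_add ?_ ?_)
        · rw [abs_mul, abs_mul]
          calc _ ≤ C * 1 * M := by gcongr
            _ = C * M := by ring
        · rw [add_mul]
          refine (abs_add_le _ _).trans (add_le_add ?_ ?_)
          · rw [abs_mul, abs_mul (X n (planar p)), mul_assoc]
            gcongr
          · rw [abs_mul, abs_mul]
            calc _ ≤ (L : ℝ) * 1 * M := by gcongr
              _ = L * M := by ring
      · have : dψ n p = 0 := by
          simp only [hdψ, hX0' n _ hpK, hdX0 n _ _ hpK]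
          ring
        rw [this, norm_zero]
        positivity
    · filter_upwards [ae_restrict_mem hΩ.isOpen_film.measurableSet,
        ae_restrict_of_ae (quasiMeasurePreserving_planar.ae (hXdt (planar e)))] with p hp hpd
      refine Tendsto.const_mul _ ?_
      have t1 := (hXt (planar p)).mul (hev p hp).1
      have t2 := (hXt (planar p)).mul ((hev p hp).2.mul_const (e 2))
      have t3 := hpd.mul (hev p hp).1
      have := (t1.mul_const (partialDeriv i ζ p)).add ((t2.add t3).mul_const (ζ p))
      convert! this using 2
      simp only [cutoffGrad, ← hχ, ← he]
      ring
  have lim2 : Tendsto (fun n => - ∫ p in Ω, G₀ p i * ψ n p) atTop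
      (𝓝 (- ∫ p in Ω, G₀ p i * (χ (planar p) * ζ p))) := by
    refine Tendsto.neg (tendsto_integral_of_dominated_convergence (fun p => ‖G₀ p i‖ * (C * M))
      (fun n => ?_) (hG1.norm.mul_const _) (fun n => ?_) ?_)
    · refine hG1.1.mul (Continuous.aestronglyMeasurable ?_)
      have := hXc n; have := hθc n
      simp only [hψ]
      fun_prop
    · filter_upwards [ae_restrict_mem hΩ.isOpen_film.measurableSet] with p hp
      rw [norm_mul]
      gcongr
      by_cases hpK : planar p ∈ K
      · have b1 := hMζ p (hmem p hp hpK)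
        rw [Real.norm_eq_abs, abs_mul, abs_mul]
        calc _ ≤ C * 1 * M := by
              gcongr
              · exact hXb' n _
              · exact hθb n _
          _ = C * M := by ring
      · have : ψ n p = 0 := by simp only [hψ, hX0' n _ hpK, zero_mul]
        rw [this, norm_zero]
        positivity
    · filter_upwards [ae_restrict_mem hΩ.isOpen_film.measurableSet] with p hp
      refine Tendsto.const_mul _ ?_
      simpa using ((hXt (planar p)).mul (hev p hp).1).mul_const (ζ p)
  have hlim := tendsto_nhds_unique (lim1.congr hweak) lim2
  have hdχb : ∀ p, |cutoffGrad η δ D p i| ≤ L := fun p =>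
    (norm_lineDeriv_le_of_lipschitz ℝ hL).trans
      (mul_le_of_le_one_right L.2 (norm_planar_single_le i))
  have hdχm : Measurable fun p => cutoffGrad η δ D p i :=
    (EuclideanSpace.proj (𝕜 := ℝ) i).measurable.comp (measurable_cutoffGrad hη δ D)
  have i1 : IntegrableOn (fun p => φ p * (χ (planar p) * partialDeriv i ζ p)) Ω := by
    refine hφ1.mul_bdd (c := 1 * M) (Continuous.aestronglyMeasurable (by fun_prop)) ?_
    filter_upwards [ae_restrict_mem hΩ.isOpen_film.measurableSet] with p hp
    rw [norm_mul]
    by_cases hpK : planar p ∈ K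
    · gcongr
      · exact abs_cutoff_le_one hη _
      · exact hMd p (hmem p hp hpK)
    · rw [hχ0 _ hpK, norm_zero, zero_mul]; positivity
  have i2 : IntegrableOn (fun p => φ p * (cutoffGrad η δ D p i * ζ p)) Ω := by
    refine hφ1.mul_bdd (c := L * M) (hdχm.mul hζc.measurable).aestronglyMeasurable ?_
    filter_upwards [ae_restrict_mem hΩ.isOpen_film.measurableSet] with p hp
    rw [norm_mul]
    by_cases hpK : planar p ∈ K
    · gcongr
      · exact hdχb p
      · exact hMζ p (hmem p hp hpK)
    · have : cutoffGrad η δ D p i = 0 := hdχ0 _ _ hpK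
      rw [this, norm_zero, zero_mul]; positivity
  have i3 : IntegrableOn (fun p => G₀ p i * (χ (planar p) * ζ p)) Ω := by
    refine hG1.mul_bdd (c := 1 * M) (Continuous.aestronglyMeasurable (by fun_prop)) ?_
    filter_upwards [ae_restrict_mem hΩ.isOpen_film.measurableSet] with p hp
    rw [norm_mul]
    by_cases hpK : planar p ∈ K
    · gcongr
      · exact abs_cutoff_le_one hη _
      · exact hMζ p (hmem p hp hpK)
    · rw [hχ0 _ hpK, norm_zero, zero_mul]; positivity
  have hsplit : ∫ p in Ω, φ p * (χ (planar p) * partialDeriv i ζ p + cutoffGrad η δ D p i * ζ p)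
      = (∫ p in Ω, φ p * (χ (planar p) * partialDeriv i ζ p))
        + ∫ p in Ω, φ p * (cutoffGrad η δ D p i * ζ p) := by
    rw [← integral_add i1 i2]
    simp only [mul_add]
  have hl : ∫ p in Ω, cutField η δ D Ω φ p * partialDeriv i ζ p
      = ∫ p in Ω, φ p * (χ (planar p) * partialDeriv i ζ p) := by
    refine setIntegral_congr_fun hΩ.isOpen_film.measurableSet fun p hp => ?_
    simp only [cutField, Set.indicator_of_mem hp, hχ]
    ring
  have hr : ∫ p in Ω, cutGrad η δ D φ G₀ p i * ζ p
      = (∫ p in Ω, G₀ p i * (χ (planar p) * ζ p))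
        + ∫ p in Ω, φ p * (cutoffGrad η δ D p i * ζ p) := by
    rw [← integral_add i3 i2]
    refine integral_congr_ae (Eventually.of_forall fun p => ?_)
    simp only [cutGrad, PiLp.add_apply, PiLp.smul_apply, smul_eq_mul, hχ]
    ring
  rw [hl, hr]
  linarith

end WeakGradient

/-! ### Volume and surface charges -/

section Charges

open Filter Topology

variable {δ R : ℝ} {f a b u : E3 → ℝ}

lemma IsSlabFunction.neg (hf : IsSlabFunction δ R f) : IsSlabFunction δ R (-f) :=
  ⟨hf.memLp.neg, fun p hp => by simp [hf.eq_zero p hp]⟩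

lemma IsSlabFunction.add (hf : IsSlabFunction δ R f) (hu : IsSlabFunction δ R u) :
    IsSlabFunction δ R (f + u) :=
  ⟨hf.memLp.add hu.memLp, fun p hp => by simp [hf.eq_zero p hp, hu.eq_zero p hp]⟩

lemma IsSlabFunction.integrable_smul {E : Type*} [NormedAddCommGroup E] [NormedSpace ℝ E]
    (hf : IsSlabFunction δ R f) {ζ : E3 → E} (hζ : Continuous ζ) :
    Integrable fun p => f p • ζ p := by
  have hK : IsCompact (closure (slabSet δ R)) := (isBounded_slabSet δ R).isCompact_closure
  refine (hf.integrable.integrableOn.smul_continuousOn hζ.continuousOn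
    hK).integrable_of_forall_notMem_eq_zero fun p hp => ?_
  rw [hf.eq_zero p fun h => hp (subset_closure h), zero_smul]

lemma IsSlabFunction.continuous_mul (hf : IsSlabFunction δ R f) {ζ : E3 → ℝ} (hζ : Continuous ζ) :
    IsSlabFunction δ R fun p => ζ p * f p := by
  obtain ⟨C, hC⟩ := (isBounded_slabSet δ R).isCompact_closure.exists_bound_of_continuousOn
    hζ.continuousOn
  refine ⟨MemLp.of_le_mul (c := C) hf.memLp (hζ.aestronglyMeasurable.mul hf.memLp.1)
    (Eventually.of_forall fun p => ?_), fun p hp => by simp [hf.eq_zero p hp]⟩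
  rw [norm_mul]
  by_cases hp : p ∈ slabSet δ R
  · gcongr
    exact hC p (subset_closure hp)
  · simp [hf.eq_zero p hp]

/-- The measure with density the positive part of `f`. -/
noncomputable def posDensity (f : E3 → ℝ) : Measure E3 :=
  volume.withDensity fun p => ENNReal.ofReal (f p)

lemma aemeasurable_ofReal (hf : IsSlabFunction δ R f) :
    AEMeasurable (fun p => ENNReal.ofReal (f p)) :=
  hf.memLp.1.aemeasurable.ennreal_ofReal

lemma isFiniteMeasure_posDensity (hf : IsSlabFunction δ R f) : IsFiniteMeasure (posDensity f) :=
  isFiniteMeasure_withDensity_ofReal hf.integrable.2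

lemma integrable_posDensity {E : Type*} [NormedAddCommGroup E] [NormedSpace ℝ E]
    (hf : IsSlabFunction δ R f) {ζ : E3 → E} (hζ : Continuous ζ) :
    Integrable ζ (posDensity f) := by
  rw [posDensity, integrable_withDensity_iff_integrable_smul₀' (aemeasurable_ofReal hf) (by simp)]
  refine (hf.integrable_smul hζ).mono ?_ (Eventually.of_forall fun p => ?_)
  · exact (aemeasurable_ofReal hf).ennreal_toReal.aestronglyMeasurable.smul hζ.aestronglyMeasurable
  · rw [norm_smul, norm_smul, ENNReal.toReal_ofReal', Real.norm_of_nonneg (le_max_right _ _)]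
    gcongr
    exact max_le (le_abs_self _) (abs_nonneg _)

/-- The measures `posDensity f` and `posDensity (-f)` are the positive and the negative part of the
signed measure with density `f`. -/
lemma integral_posDensity_sub {E : Type*} [NormedAddCommGroup E] [NormedSpace ℝ E]
    (hf : IsSlabFunction δ R f) {ζ : E3 → E} (hζ : Continuous ζ) :
    ∫ p, ζ p ∂(posDensity f) - ∫ p, ζ p ∂(posDensity (-f)) = ∫ p, f p • ζ p := by
  have h1 := integrable_posDensity hf hζ
  have h2 := integrable_posDensity hf.neg hζ
  rw [posDensity, integrable_withDensity_iff_integrable_smul₀' (aemeasurable_ofReal hf) (by simp)]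
    at h1
  rw [posDensity, integrable_withDensity_iff_integrable_smul₀' (aemeasurable_ofReal hf.neg)
    (by simp)] at h2
  rw [posDensity, posDensity,
    integral_withDensity_eq_integral_toReal_smul₀ (aemeasurable_ofReal hf) (by simp),
    integral_withDensity_eq_integral_toReal_smul₀ (aemeasurable_ofReal hf.neg) (by simp),
    ← integral_sub h1 h2]
  refine integral_congr_ae (Eventually.of_forall fun p => ?_)
  simp only [ENNReal.toReal_ofReal', Pi.neg_apply, ← sub_smul]
  congr 1
  rcases le_total (f p) 0 with h | h
  · rw [max_eq_right h, max_eq_left (by linarith)]; ring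
  · rw [max_eq_left h, max_eq_right (by linarith)]; ring

/-- The positive part of a volume charge `f`, plus the positive parts of the charges `a` and `b`
after these have been moved vertically to the bottom `z = 0` and to the top `z = δ`. -/
noncomputable def chargeMeasure (δ : ℝ) (f a b : E3 → ℝ) : Measure E3 :=
  posDensity f + (posDensity a).map (fun p => atHeight (planar p) 0)
    + (posDensity b).map (fun p => atHeight (planar p) δ)

lemma continuous_toHeight (c : ℝ) : Continuous fun p : E3 => atHeight (planar p) c :=
  (contDiff_atHeight c).continuous

lemma isFiniteMeasure_chargeMeasure (hf : IsSlabFunction δ R f) (ha : IsSlabFunction δ R a)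
    (hb : IsSlabFunction δ R b) : IsFiniteMeasure (chargeMeasure δ f a b) := by
  have := isFiniteMeasure_posDensity hf
  have := isFiniteMeasure_posDensity ha
  have := isFiniteMeasure_posDensity hb
  unfold chargeMeasure
  infer_instance

lemma integral_chargeMeasure {E : Type*} [NormedAddCommGroup E] [NormedSpace ℝ E]
    (hf : IsSlabFunction δ R f) (ha : IsSlabFunction δ R a) (hb : IsSlabFunction δ R b)
    {ζ : E3 → E} (hζ : Continuous ζ) :
    Integrable ζ (chargeMeasure δ f a b) ∧ ∫ p, ζ p ∂(chargeMeasure δ f a b)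
      = ∫ p, ζ p ∂(posDensity f) + ∫ p, ζ (atHeight (planar p) 0) ∂(posDensity a)
        + ∫ p, ζ (atHeight (planar p) δ) ∂(posDensity b) := by
  have h0 := continuous_toHeight 0
  have hd := continuous_toHeight δ
  have i1 := integrable_posDensity hf hζ
  have i2 : Integrable ζ ((posDensity a).map fun p => atHeight (planar p) 0) :=
    (integrable_map_measure hζ.aestronglyMeasurable h0.aemeasurable).2
      (integrable_posDensity ha (hζ.comp h0))
  have i3 : Integrable ζ ((posDensity b).map fun p => atHeight (planar p) δ) :=
    (integrable_map_measure hζ.aestronglyMeasurable hd.aemeasurable).2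
      (integrable_posDensity hb (hζ.comp hd))
  refine ⟨(i1.add_measure i2).add_measure i3, ?_⟩
  rw [chargeMeasure, integral_add_measure (i1.add_measure i2) i3, integral_add_measure i1 i2,
    integral_map h0.aemeasurable hζ.aestronglyMeasurable,
    integral_map hd.aemeasurable hζ.aestronglyMeasurable]

lemma integral_chargeMeasure_sub {E : Type*} [NormedAddCommGroup E] [NormedSpace ℝ E]
    (hf : IsSlabFunction δ R f) (ha : IsSlabFunction δ R a) (hb : IsSlabFunction δ R b)
    {ζ : E3 → E} (hζ : Continuous ζ) :
    ∫ p, ζ p ∂(chargeMeasure δ f a b) - ∫ p, ζ p ∂(chargeMeasure δ (-f) (-a) (-b))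
      = (∫ p, f p • ζ p) + (∫ p, a p • ζ (atHeight (planar p) 0))
        + ∫ p, b p • ζ (atHeight (planar p) δ) := by
  have ea := integral_posDensity_sub ha (ζ := fun p => ζ (atHeight (planar p) 0))
    (hζ.comp (continuous_toHeight 0))
  have eb := integral_posDensity_sub hb (ζ := fun p => ζ (atHeight (planar p) δ))
    (hζ.comp (continuous_toHeight δ))
  rw [(integral_chargeMeasure hf ha hb hζ).2, (integral_chargeMeasure hf.neg ha.neg hb.neg hζ).2,
    ← integral_posDensity_sub hf hζ, ← ea, ← eb]
  abel

lemma lintegral_posDensity (hf : IsSlabFunction δ R f) {k : E3 → ℝ≥0∞} (hk : Measurable k) :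
    ∫⁻ p, k p ∂(posDensity f) = ∫⁻ p, ENNReal.ofReal (f p) * k p :=
  lintegral_withDensity_eq_lintegral_mul₀ (aemeasurable_ofReal hf) hk.aemeasurable

lemma ofReal_add_ofReal_neg (x : ℝ) : ENNReal.ofReal x + ENNReal.ofReal (-x) = ‖x‖ₑ := by
  rw [← ofReal_norm]
  rcases le_total x 0 with h | h
  · rw [ENNReal.ofReal_of_nonpos h, zero_add, Real.norm_of_nonpos h]
  · rw [ENNReal.ofReal_of_nonpos (by linarith : -x ≤ 0), add_zero, Real.norm_of_nonneg h]

/-- Moving charges vertically does not change what they look like from above. -/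
lemma lintegral_chargeMeasure_planar (hf : IsSlabFunction δ R f) (ha : IsSlabFunction δ R a)
    (hb : IsSlabFunction δ R b) {k : E2 → ℝ≥0∞} (hk : Measurable k) :
    ∫⁻ p, k (planar p) ∂(chargeMeasure δ f a b + chargeMeasure δ (-f) (-a) (-b))
      = ∫⁻ p, (‖f p‖ₑ + ‖a p‖ₑ + ‖b p‖ₑ) * k (planar p) := by
  have hkp : Measurable fun p => k (planar p) := hk.comp continuous_planar.measurable
  have key : ∀ {f a b : E3 → ℝ}, IsSlabFunction δ R f → IsSlabFunction δ R a →
      IsSlabFunction δ R b → ∫⁻ p, k (planar p) ∂(chargeMeasure δ f a b)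
        = ∫⁻ p, (ENNReal.ofReal (f p) + ENNReal.ofReal (a p) + ENNReal.ofReal (b p))
          * k (planar p) := by
    intro f a b hf ha hb
    rw [chargeMeasure, lintegral_add_measure, lintegral_add_measure,
      lintegral_map hkp (continuous_toHeight 0).measurable,
      lintegral_map hkp (continuous_toHeight δ).measurable]
    simp only [planar_atHeight, add_mul]
    have m₁ : AEMeasurable fun p => ENNReal.ofReal (f p) * k (planar p) :=
      (aemeasurable_ofReal hf).mul hkp.aemeasurable
    have m₂ : AEMeasurable fun p =>
        ENNReal.ofReal (f p) * k (planar p) + ENNReal.ofReal (a p) * k (planar p) :=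
      m₁.add ((aemeasurable_ofReal ha).mul hkp.aemeasurable)
    rw [lintegral_posDensity hf hkp, lintegral_posDensity ha hkp, lintegral_posDensity hb hkp,
      lintegral_add_left' m₂, lintegral_add_left' m₁]
  have hm : AEMeasurable fun p =>
      (ENNReal.ofReal (f p) + ENNReal.ofReal (a p) + ENNReal.ofReal (b p)) * k (planar p) :=
    (((aemeasurable_ofReal hf).add (aemeasurable_ofReal ha)).add (aemeasurable_ofReal hb)).mul
      hkp.aemeasurable
  rw [lintegral_add_measure, key hf ha hb, key hf.neg ha.neg hb.neg, ← lintegral_add_left' hm]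
  refine lintegral_congr fun p => ?_
  simp only [Pi.neg_apply, ← ofReal_add_ofReal_neg, ← add_mul]
  congr 1
  ring

/-- Integrating by parts against `ζ` minus its linear interpolation between bottom and top
produces the boundary charges. -/
lemma integral_mul_partialDeriv_two (hδ : 0 < δ) (hu : IsSlabFunction δ R u)
    (hf : IsSlabFunction δ R f)
    (hparts : ∀ ζ : E3 → ℝ, ContDiff ℝ (⊤ : ℕ∞) ζ →
      (∀ r, ζ (atHeight r 0) = 0 ∧ ζ (atHeight r δ) = 0) →
      ∫ p, u p * partialDeriv 2 ζ p = - ∫ p, f p * ζ p)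
    {ζ : E3 → ℝ} (hζ : ContDiff ℝ (⊤ : ℕ∞) ζ) :
    ∫ p, u p * partialDeriv 2 ζ p = - ((∫ p, f p * ζ p)
      + (∫ p, (δ⁻¹ * (u p - (δ - p 2) * f p)) * ζ (atHeight (planar p) 0))
      + ∫ p, (-(δ⁻¹ * (u p + p 2 * f p))) * ζ (atHeight (planar p) δ)) := by
  set ζ₀ : E3 → ℝ := fun p => ζ (atHeight (planar p) 0) with hζ₀
  set ζ₁ : E3 → ℝ := fun p => ζ (atHeight (planar p) δ) with hζ₁
  have hs₀ : ContDiff ℝ (⊤ : ℕ∞) ζ₀ := hζ.comp (contDiff_atHeight 0)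
  have hs₁ : ContDiff ℝ (⊤ : ℕ∞) ζ₁ := hζ.comp (contDiff_atHeight δ)
  have hsz : ContDiff ℝ (⊤ : ℕ∞) fun p : E3 => p 2 :=
    (EuclideanSpace.proj (𝕜 := ℝ) (2 : Fin 3)).contDiff
  -- `ζ` minus its linear interpolation between the bottom and the top.
  set ξ : E3 → ℝ := fun p => ζ p - (δ⁻¹ * (δ - p 2) * ζ₀ p + δ⁻¹ * p 2 * ζ₁ p) with hξ
  have hsξ : ContDiff ℝ (⊤ : ℕ∞) ξ := by
    simp only [hξ]
    fun_prop
  have hv : ∀ r, ξ (atHeight r 0) = 0 ∧ ξ (atHeight r δ) = 0 := by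
    intro r
    constructor
    · simp [hξ, hζ₀, hδ.ne']
    · simp [hξ, hζ₁, hδ.ne']
  have hd : ∀ p, partialDeriv 2 ξ p = partialDeriv 2 ζ p - δ⁻¹ * (ζ₁ p - ζ₀ p) := by
    intro p
    have e1 := hasDerivAt_comp_atHeight hsξ (planar p) (p 2)
    have e2 := hasDerivAt_comp_atHeight hζ (planar p) (p 2)
    rw [atHeight_planar] at e1 e2
    have e3 : HasDerivAt (fun z => δ⁻¹ * (δ - z) * ζ₀ p + δ⁻¹ * z * ζ₁ p)
        (δ⁻¹ * (ζ₁ p - ζ₀ p)) (p 2) := by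
      have a1 := (((hasDerivAt_id (p 2)).const_sub δ).const_mul δ⁻¹).mul_const (ζ₀ p)
      have a2 := ((hasDerivAt_id (p 2)).const_mul δ⁻¹).mul_const (ζ₁ p)
      convert! a1.add a2 using 1
      ring
    refine e1.unique ?_
    exact e2.sub e3
  have key := hparts ξ hsξ hv
  have c := hζ.continuous
  have c₀ := hs₀.continuous
  have c₁ := hs₁.continuous
  have cz : Continuous fun p : E3 => p 2 := hsz.continuous
  have i1 : Integrable fun p => u p * partialDeriv 2 ζ p :=
    hu.integrable_smul (continuous_partialDeriv hζ 2)
  have i2 : Integrable fun p => u p * (δ⁻¹ * (ζ₁ p - ζ₀ p)) := hu.integrable_smul (by fun_prop)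
  have i3 : Integrable fun p => f p * ζ p := hf.integrable_smul c
  have i4 : Integrable fun p => f p * (δ⁻¹ * (δ - p 2) * ζ₀ p + δ⁻¹ * p 2 * ζ₁ p) :=
    hf.integrable_smul (by fun_prop)
  have i5 : Integrable fun p => (δ⁻¹ * (u p - (δ - p 2) * f p)) * ζ₀ p := by
    have h1 : Integrable fun p => u p * (δ⁻¹ * ζ₀ p) := hu.integrable_smul (by fun_prop)
    have h2 : Integrable fun p => f p * (δ⁻¹ * (δ - p 2) * ζ₀ p) := hf.integrable_smul (by fun_prop)
    refine (h1.sub h2).congr (Eventually.of_forall fun p => ?_)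
    simp only [Pi.sub_apply]
    ring
  have i6 : Integrable fun p => (-(δ⁻¹ * (u p + p 2 * f p))) * ζ₁ p := by
    have h1 : Integrable fun p => u p * (-δ⁻¹ * ζ₁ p) := hu.integrable_smul (by fun_prop)
    have h2 : Integrable fun p => f p * (-δ⁻¹ * p 2 * ζ₁ p) := hf.integrable_smul (by fun_prop)
    refine (h1.add h2).congr (Eventually.of_forall fun p => ?_)
    simp only [Pi.add_apply]
    ring
  have e : (∫ p, (δ⁻¹ * (u p - (δ - p 2) * f p)) * ζ₀ p)
      + ∫ p, (-(δ⁻¹ * (u p + p 2 * f p))) * ζ₁ p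
      = -(∫ p, u p * (δ⁻¹ * (ζ₁ p - ζ₀ p)))
        - ∫ p, f p * (δ⁻¹ * (δ - p 2) * ζ₀ p + δ⁻¹ * p 2 * ζ₁ p) := by
    have i2n : Integrable fun p => -(u p * (δ⁻¹ * (ζ₁ p - ζ₀ p))) := i2.neg
    rw [← integral_add i5 i6, ← integral_neg, ← integral_sub i2n i4]
    exact integral_congr_ae (Eventually.of_forall fun p => by ring)
  have key' : (∫ p, u p * partialDeriv 2 ζ p) - (∫ p, u p * (δ⁻¹ * (ζ₁ p - ζ₀ p)))
      = -((∫ p, f p * ζ p) - ∫ p, f p * (δ⁻¹ * (δ - p 2) * ζ₀ p + δ⁻¹ * p 2 * ζ₁ p)) := by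
    rw [← integral_sub i1 i2, ← integral_sub i3 i4]
    simp only [hd] at key
    simp only [← mul_sub]
    exact key
  linarith

end Charges

/-! ### Finiteness of the energy -/

section FiniteEnergy

open Filter Topology

/-- The kernel `1 / |r - r'|` is integrable over discs in the plane, uniformly in `r`. -/
lemma exists_lintegral_inv_edist_le (R : ℝ) :
    ∃ C : ℝ≥0∞, C ≠ ∞ ∧ ∀ r : E2, ∫⁻ r' in Metric.ball (0 : E2) R, (edist r r')⁻¹ ≤ C := by
  set C₁ : ℝ≥0∞ := ∫⁻ x in Metric.ball (0 : E2) 1, (‖x‖ₑ)⁻¹ with hC₁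
  have hC : C₁ ≠ ∞ := by
    have h1 : IntegrableOn (fun x : E2 => ‖x‖⁻¹) (Metric.ball 0 1) := by
      rw [integrableOn_fun_norm_addHaar volume (f := fun y : ℝ => y⁻¹)]
      have h2 : IntegrableOn (fun _ : ℝ => (1 : ℝ)) (Set.Ioo 0 1) := by simp
      refine h2.congr_fun (fun y hy => ?_) measurableSet_Ioo
      have := hy.1.ne'
      simp [this]
    have h3 := h1.2
    rw [hasFiniteIntegral_iff_enorm] at h3
    refine ne_of_lt (lt_of_le_of_lt (le_of_eq ?_) h3)
    refine lintegral_congr_ae ?_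
    filter_upwards [ae_restrict_of_ae (compl_mem_ae_iff.2 (measure_singleton (0 : E2)))] with x hx
    have hx' : 0 < ‖x‖ := norm_pos_iff.2 hx
    rw [← ofReal_norm, ← ofReal_norm, Real.norm_of_nonneg (by positivity),
      ENNReal.ofReal_inv_of_pos hx']
  refine ⟨C₁ + volume (Metric.ball (0 : E2) R), ENNReal.add_ne_top.2 ⟨hC, measure_ball_lt_top.ne⟩,
    fun r => ?_⟩
  set g : E2 → ℝ≥0∞ := (Metric.ball (0 : E2) 1).indicator fun x => (‖x‖ₑ)⁻¹ with hg
  have hgm : Measurable g := (measurable_enorm.inv).indicator measurableSet_ball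
  have hle : ∀ r', (edist r r')⁻¹ ≤ g (r - r') + 1 := by
    intro r'
    by_cases h : r - r' ∈ Metric.ball (0 : E2) 1
    · rw [hg, Set.indicator_of_mem h, edist_eq_enorm_sub]
      exact le_self_add
    · rw [hg, Set.indicator_of_notMem h, zero_add, ENNReal.inv_le_one, edist_dist, dist_eq_norm]
      rw [mem_ball_zero_iff, not_lt] at h
      exact ENNReal.one_le_ofReal.2 h
  calc ∫⁻ r' in Metric.ball (0 : E2) R, (edist r r')⁻¹
      ≤ ∫⁻ r' in Metric.ball (0 : E2) R, (g (r - r') + 1) := lintegral_mono fun r' => hle r'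
    _ = (∫⁻ r' in Metric.ball (0 : E2) R, g (r - r')) + volume (Metric.ball (0 : E2) R) := by
        rw [lintegral_add_right _ measurable_const]
        simp
    _ ≤ (∫⁻ r', g (r - r')) + volume (Metric.ball (0 : E2) R) := by
        gcongr
        exact Measure.restrict_le_self
    _ = C₁ + volume (Metric.ball (0 : E2) R) := by
        rw [lintegral_sub_left_eq_self g r, hg, lintegral_indicator measurableSet_ball]

lemma setLIntegral_slabSet_planar (δ R : ℝ) {k : E2 → ℝ≥0∞} (hk : Measurable k) :
    ∫⁻ q in slabSet δ R, k (planar q) = ENNReal.ofReal δ * ∫⁻ r in Metric.ball 0 R, k r := by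
  have h : slabSet δ R = sliceEquiv ⁻¹' (Metric.ball (0 : E2) R ×ˢ Set.Ioo 0 δ) := rfl
  have h2 := measurePreserving_sliceEquiv.setLIntegral_comp_preimage_emb
    sliceEquiv.measurableEmbedding (fun w => k w.1) (Metric.ball (0 : E2) R ×ˢ Set.Ioo 0 δ)
  rw [h]
  refine Eq.trans h2 ?_
  have hk₁ : Measurable fun w : E2 × ℝ => k w.1 := hk.comp measurable_fst
  rw [Measure.volume_eq_prod, ← Measure.prod_restrict, lintegral_prod _ hk₁.aemeasurable]
  simp only [lintegral_const, MeasurableSet.univ, Measure.restrict_apply, Set.univ_inter,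
    Real.volume_Ioo, sub_zero]
  rw [lintegral_mul_const _ hk, mul_comm]

/-- Schur's test for a symmetric kernel on a set `S`. -/
lemma lintegral_kernel_le {α : Type*} [MeasurableSpace α] {m : Measure α} [SFinite m]
    {K : α → α → ℝ≥0∞} (hKm : Measurable (Function.uncurry K)) (hsymm : ∀ p q, K q p = K p q)
    {S : Set α} (hSm : MeasurableSet S) {C : ℝ≥0∞} (hKS : ∀ p, ∫⁻ q in S, K p q ∂m ≤ C)
    {s : α → ℝ≥0∞} (hs : AEMeasurable s m) (hs0 : ∀ p, p ∉ S → s p = 0) :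
    ∫⁻ p, s p * ∫⁻ q, s q * K p q ∂m ∂m ≤ 2 * ((∫⁻ p, s p ^ 2 ∂m) * C) := by
  have hKm' : ∀ p, Measurable (K p) := fun p => hKm.comp measurable_prodMk_left
  -- Bound `s p * s q` by `s p ^ 2 + s q ^ 2` and use the symmetry of the kernel.
  set T : α → α → ℝ≥0∞ := fun p q => s p ^ 2 * (S.indicator 1 q * K p q) with hT
  have hTm : AEMeasurable (Function.uncurry T) (m.prod m) := by
    have h1 : AEMeasurable (fun w : α × α => s w.1 ^ 2) (m.prod m) := hs.comp_fst.pow_const 2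
    have h2 : Measurable fun w : α × α => S.indicator (1 : α → ℝ≥0∞) w.2 :=
      ((measurable_one).indicator hSm).comp measurable_snd
    exact h1.mul (h2.mul hKm).aemeasurable
  have hTint : ∫⁻ p, ∫⁻ q, T p q ∂m ∂m ≤ (∫⁻ p, s p ^ 2 ∂m) * C := by
    rw [← lintegral_mul_const'' _ (hs.pow_const 2)]
    refine lintegral_mono fun p => ?_
    simp only [hT]
    have mS : Measurable fun q => S.indicator 1 q * K p q :=
      (measurable_one.indicator hSm).mul (hKm' p)
    rw [lintegral_const_mul _ mS]
    gcongr
    refine le_trans (le_of_eq ?_) (hKS p)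
    rw [← lintegral_indicator hSm]
    refine lintegral_congr fun q => ?_
    by_cases hq : q ∈ S <;> simp [hq]
  have hpt : ∀ p q, s p * (s q * K p q) ≤ T p q + T q p := by
    intro p q
    by_cases hp : p ∈ S
    · by_cases hq : q ∈ S
      · simp only [hT, hsymm p q, Set.indicator_of_mem hp, Set.indicator_of_mem hq, Pi.one_apply,
          one_mul]
        rw [← mul_assoc, ← add_mul]
        gcongr
        rcases le_total (s p) (s q) with h | h
        · calc s p * s q ≤ s q * s q := by gcongr
            _ ≤ s p ^ 2 + s q ^ 2 := by rw [← sq]; exact le_add_self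
        · calc s p * s q ≤ s p * s p := by gcongr
            _ ≤ s p ^ 2 + s q ^ 2 := by rw [← sq]; exact le_self_add
      · simp [hs0 q hq]
    · simp [hs0 p hp]
  calc ∫⁻ p, s p * ∫⁻ q, s q * K p q ∂m ∂m
      = ∫⁻ p, ∫⁻ q, s p * (s q * K p q) ∂m ∂m := by
        refine lintegral_congr fun p => ?_
        have ms : AEMeasurable (fun q => s q * K p q) m := hs.mul (hKm' p).aemeasurable
        rw [lintegral_const_mul'' _ ms]
    _ ≤ ∫⁻ p, ∫⁻ q, (T p q + T q p) ∂m ∂m :=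
        lintegral_mono fun p => lintegral_mono fun q => hpt p q
    _ = (∫⁻ p, ∫⁻ q, T p q ∂m ∂m) + ∫⁻ p, ∫⁻ q, T q p ∂m ∂m := by
        have m1 : ∀ p, Measurable (T p) := fun p =>
          (((measurable_one).indicator hSm).mul (hKm' p)).const_mul _
        simp only [lintegral_add_left (m1 _)]
        have m2 : AEMeasurable (fun p => ∫⁻ q, T p q ∂m) m := hTm.lintegral_prod_right'
        rw [lintegral_add_left' m2]
    _ = 2 * ∫⁻ p, ∫⁻ q, T p q ∂m ∂m := by
        rw [lintegral_lintegral_swap (f := fun p q => T q p) hTm.prod_swap, two_mul]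
    _ ≤ _ := by gcongr

/-- A charge whose projection to the plane is that of a square integrable density on a bounded part
of the slab has finite Newtonian energy: the planar kernel `1 / |r - r'|` dominates the Newtonian
one and is locally integrable in the plane, so that Schur's test applies. -/
theorem newtonEnergy_ne_top {κ : Measure E3} {s : E3 → ℝ≥0∞} {δ R : ℝ} (hs : AEMeasurable s)
    (hs2 : ∫⁻ p, s p ^ 2 ≠ ∞) (hs0 : ∀ p, p ∉ slabSet δ R → s p = 0)
    (hκ : ∀ k : E2 → ℝ≥0∞, Measurable k →
      ∫⁻ p, k (planar p) ∂κ = ∫⁻ p, s p * k (planar p)) :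
    newtonEnergy κ κ ≠ ∞ := by
  obtain ⟨C₀, hC₀, hC⟩ := exists_lintegral_inv_edist_le R
  obtain ⟨k, hk⟩ : ∃ k : E2 → E2 → ℝ≥0∞, k = fun r r' => (edist r r')⁻¹ := ⟨_, rfl⟩
  have hkm : Measurable fun w : E2 × E2 => k w.1 w.2 := by
    rw [hk]
    exact (measurable_fst.edist measurable_snd).inv
  have hk₁ : ∀ r, Measurable (k r) := fun r => hkm.comp measurable_prodMk_left
  have hpm := continuous_planar.measurable
  have hbound := lintegral_kernel_le (m := volume) (K := fun p q : E3 => k (planar p) (planar q))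
    (S := slabSet δ R) (C := ENNReal.ofReal δ * C₀)
    (hkm.comp ((hpm.comp measurable_fst).prodMk (hpm.comp measurable_snd)))
    (fun p q => by rw [hk]; exact congrArg _ (edist_comm _ _)) (measurableSet_slabSet δ R)
    (fun p => by
      rw [setLIntegral_slabSet_planar δ R (hk₁ _)]
      gcongr
      rw [hk]
      exact hC _) hs hs0
  have hdom : ∫⁻ p, ∫⁻ q, (edist p q)⁻¹ ∂κ ∂κ
      ≤ ∫⁻ p, ∫⁻ q, k (planar p) (planar q) ∂κ ∂κ := by
    refine lintegral_mono fun p => lintegral_mono fun q => ?_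
    rw [hk]
    refine ENNReal.inv_le_inv.2 ?_
    rw [edist_dist, edist_dist, dist_eq_norm, dist_eq_norm, ← planar_sub]
    exact ENNReal.ofReal_le_ofReal (norm_planar_le _)
  have hmid' : ∀ r : E2, ∫⁻ q, k r (planar q) ∂(volume.withDensity s)
      = ∫⁻ q, s q * k r (planar q) := fun r =>
    lintegral_withDensity_eq_lintegral_mul₀ hs ((hk₁ r).comp hpm).aemeasurable
  -- `s` is only almost everywhere measurable, so measurability in `r` is seen from the measure.
  have hmid : Measurable fun r : E2 => ∫⁻ q, s q * k r (planar q) := by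
    simp only [← hmid']
    exact Measurable.lintegral_prod_right
      (hkm.comp (measurable_fst.prodMk (hpm.comp measurable_snd)))
  have h1 : ∫⁻ p, ∫⁻ q, k (planar p) (planar q) ∂κ ∂κ
      = ∫⁻ p, s p * ∫⁻ q, s q * k (planar p) (planar q) := by
    simp only [hκ _ (hk₁ _)]
    exact hκ _ hmid
  rw [h1] at hdom
  refine ENNReal.mul_ne_top ENNReal.ofReal_ne_top (ne_top_of_le_ne_top ?_ (hdom.trans hbound))
  exact ENNReal.mul_ne_top (by simp) (ENNReal.mul_ne_top hs2
    (ENNReal.mul_ne_top ENNReal.ofReal_ne_top hC₀))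

end FiniteEnergy

/-! ### The estimate for the film -/

section Assembly

open Filter Topology

variable {δ R : ℝ} {u f g : E3 → ℝ}

lemma fourier_eq_integral_planeWave (u : E3 → ℝ) (ξ : E3) :
    𝓕 (fun p => (u p : ℂ)) ξ = ∫ p, u p • planeWave p ξ := by
  rw [Real.fourier_eq']
  refine integral_congr_ae (Eventually.of_forall fun p => ?_)
  simp only [planeWave, smul_eq_mul, Complex.real_smul]
  rw [mul_comm]

lemma integral_ofReal_add_ofReal_mul_I {m : Measure E3} {c s : E3 → ℝ} (hc : Integrable c m)
    (hs : Integrable s m) :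
    ∫ p, ((c p : ℂ) + (s p : ℂ) * Complex.I) ∂m
      = ((∫ p, c p ∂m : ℝ) : ℂ) + ((∫ p, s p ∂m : ℝ) : ℂ) * Complex.I := by
  rw [integral_add hc.ofReal (hs.ofReal.mul_const _), integral_mul_const, integral_complex_ofReal,
    integral_complex_ofReal]

/-- If `∂ᵢ u = μ - ν`, then the Fourier transform of `μ - ν` is `2πi ξᵢ` times that of `u`. -/
lemma measureFourier_sub_eq (hu : IsSlabFunction δ R u) {μ ν : Measure E3} [IsFiniteMeasure μ]
    [IsFiniteMeasure ν] (i : Fin 3)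
    (h : ∀ ζ : E3 → ℝ, ContDiff ℝ (⊤ : ℕ∞) ζ →
      ∫ p, u p * partialDeriv i ζ p = - (∫ p, ζ p ∂μ - ∫ p, ζ p ∂ν)) (ξ : E3) :
    measureFourier μ ξ - measureFourier ν ξ
      = (2 * Real.pi * ξ i : ℝ) * Complex.I * 𝓕 (fun p => (u p : ℂ)) ξ := by
  -- The real and the imaginary part of the plane wave are the functions `ζ` to use.
  set θ : E3 → ℝ := fun p => -2 * Real.pi * inner ℝ p ξ with hθ
  have hθs : ContDiff ℝ (⊤ : ℕ∞) θ :=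
    contDiff_const.mul (contDiff_id.inner ℝ contDiff_const)
  have hθd : ∀ p, HasFDerivAt θ ((-2 * Real.pi) • innerSL ℝ ξ) p := by
    intro p
    have := ((innerSL ℝ ξ).hasFDerivAt (x := p)).const_mul (-2 * Real.pi)
    refine this.congr_of_eventuallyEq (Eventually.of_forall fun q => ?_)
    simp [hθ, real_inner_comm]
  have hc : ContDiff ℝ (⊤ : ℕ∞) fun p => Real.cos (θ p) := Real.contDiff_cos.comp hθs
  have hs : ContDiff ℝ (⊤ : ℕ∞) fun p => Real.sin (θ p) := Real.contDiff_sin.comp hθs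
  have hL : innerSL ℝ ξ (EuclideanSpace.single i (1 : ℝ)) = ξ i := by
    simp [EuclideanSpace.inner_single_right]
  have hcd : ∀ p, partialDeriv i (fun p => Real.cos (θ p)) p
      = 2 * Real.pi * ξ i * Real.sin (θ p) := by
    intro p
    rw [partialDeriv_eq (hθd p).cos]
    simp only [smul_apply, hL, smul_eq_mul]
    ring
  have hsd : ∀ p, partialDeriv i (fun p => Real.sin (θ p)) p
      = -(2 * Real.pi * ξ i) * Real.cos (θ p) := by
    intro p
    rw [partialDeriv_eq (hθd p).sin]
    simp only [smul_apply, hL, smul_eq_mul]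
    ring
  have hw : ∀ p, planeWave p ξ
      = (Real.cos (θ p) : ℂ) + (Real.sin (θ p) : ℂ) * Complex.I := by
    intro p
    rw [planeWave, Complex.exp_mul_I, ← Complex.ofReal_cos, ← Complex.ofReal_sin]
  have hbc : ∀ (m : Measure E3) [IsFiniteMeasure m], Integrable (fun p => Real.cos (θ p)) m :=
    fun m _ => Integrable.of_bound hc.continuous.aestronglyMeasurable 1
      (Eventually.of_forall fun p => Real.abs_cos_le_one _)
  have hbs : ∀ (m : Measure E3) [IsFiniteMeasure m], Integrable (fun p => Real.sin (θ p)) m :=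
    fun m _ => Integrable.of_bound hs.continuous.aestronglyMeasurable 1
      (Eventually.of_forall fun p => Real.abs_sin_le_one _)
  have hm : ∀ (m : Measure E3) [IsFiniteMeasure m], measureFourier m ξ
      = ((∫ p, Real.cos (θ p) ∂m : ℝ) : ℂ) + ((∫ p, Real.sin (θ p) ∂m : ℝ) : ℂ) * Complex.I := by
    intro m _
    rw [measureFourier, ← integral_ofReal_add_ofReal_mul_I (hbc m) (hbs m)]
    exact integral_congr_ae (Eventually.of_forall hw)
  have hU : 𝓕 (fun p => (u p : ℂ)) ξ = ((∫ p, u p * Real.cos (θ p) : ℝ) : ℂ)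
      + ((∫ p, u p * Real.sin (θ p) : ℝ) : ℂ) * Complex.I := by
    have i1 : Integrable fun p => u p * Real.cos (θ p) := hu.integrable_smul hc.continuous
    have i2 : Integrable fun p => u p * Real.sin (θ p) := hu.integrable_smul hs.continuous
    rw [fourier_eq_integral_planeWave, ← integral_ofReal_add_ofReal_mul_I i1 i2]
    refine integral_congr_ae (Eventually.of_forall fun p => ?_)
    simp only [hw, Complex.real_smul]
    push_cast
    ring
  have h1 := h _ hc
  have h2 := h _ hs
  simp only [hcd, hsd, mul_left_comm (u _), integral_const_mul] at h1 h2
  rw [hm μ, hm ν, hU]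
  have e1 : ((∫ p, Real.cos (θ p) ∂μ : ℝ) : ℂ) - ((∫ p, Real.cos (θ p) ∂ν : ℝ) : ℂ)
      = -((2 * Real.pi * ξ i * ∫ p, u p * Real.sin (θ p) : ℝ) : ℂ) := by
    rw [← Complex.ofReal_sub, ← Complex.ofReal_neg]
    congr 1
    linarith
  have e2 : ((∫ p, Real.sin (θ p) ∂μ : ℝ) : ℂ) - ((∫ p, Real.sin (θ p) ∂ν : ℝ) : ℂ)
      = ((2 * Real.pi * ξ i * ∫ p, u p * Real.cos (θ p) : ℝ) : ℂ) := by
    rw [← Complex.ofReal_sub]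
    congr 1
    linarith
  rw [Complex.ofReal_mul] at e1 e2
  linear_combination e1 + e2 * Complex.I + ((2 * Real.pi * ξ i : ℝ) : ℂ)
    * ((∫ p, u p * Real.sin (θ p) : ℝ) : ℂ) * (-Complex.I_sq)

/-- If `∂ᵢ u = g`, then the Fourier transform of `g` is `2πi ξᵢ` times that of `u`. -/
lemma fourier_eq_mul_fourier (hu : IsSlabFunction δ R u) (hg : IsSlabFunction δ R g) (i : Fin 3)
    (h : ∀ ζ : E3 → ℝ, ContDiff ℝ (⊤ : ℕ∞) ζ →
      ∫ p, u p * partialDeriv i ζ p = - ∫ p, g p * ζ p) (ξ : E3) :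
    𝓕 (fun p => (g p : ℂ)) ξ
      = (2 * Real.pi * ξ i : ℝ) * Complex.I * 𝓕 (fun p => (u p : ℂ)) ξ := by
  have := isFiniteMeasure_posDensity hg
  have := isFiniteMeasure_posDensity hg.neg
  have hw : Continuous fun p => planeWave p ξ :=
    continuous_planeWave.comp (continuous_id.prodMk continuous_const)
  rw [← measureFourier_sub_eq hu (μ := posDensity g) (ν := posDensity (-g)) i, measureFourier,
    measureFourier, integral_posDensity_sub hg hw, fourier_eq_integral_planeWave]
  intro ζ hζ
  rw [h ζ hζ, integral_posDensity_sub hg hζ.continuous]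
  rfl

/-- Plancherel's formula for the in-plane gradient. -/
lemma integral_planar_sq_mul_fourier (hu : IsSlabFunction δ R u) {g : Fin 3 → E3 → ℝ}
    (hg : ∀ i, IsSlabFunction δ R (g i))
    (h : ∀ i, i ≠ 2 → ∀ ζ : E3 → ℝ, ContDiff ℝ (⊤ : ℕ∞) ζ →
      ∫ p, u p * partialDeriv i ζ p = - ∫ p, g i p * ζ p) :
    Integrable (fun ξ : E3 => ‖planar ξ‖ ^ 2 * ‖𝓕 (fun p => (u p : ℂ)) ξ‖ ^ 2) ∧
      4 * Real.pi ^ 2 * ∫ ξ : E3, ‖planar ξ‖ ^ 2 * ‖𝓕 (fun p => (u p : ℂ)) ξ‖ ^ 2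
        = (∫ p, g 0 p ^ 2) + ∫ p, g 1 p ^ 2 := by
  have hpi : (4 * Real.pi ^ 2) ≠ 0 := by positivity
  have hp : ∀ i : Fin 3, i ≠ 2 →
      Integrable (fun ξ : E3 => 4 * Real.pi ^ 2 * (ξ i ^ 2 * ‖𝓕 (fun p => (u p : ℂ)) ξ‖ ^ 2)) ∧
      ∫ ξ : E3, 4 * Real.pi ^ 2 * (ξ i ^ 2 * ‖𝓕 (fun p => (u p : ℂ)) ξ‖ ^ 2)
        = ∫ p, g i p ^ 2 := by
    intro i hi
    have e : ∀ ξ : E3, 4 * Real.pi ^ 2 * (ξ i ^ 2 * ‖𝓕 (fun p => (u p : ℂ)) ξ‖ ^ 2)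
        = ‖𝓕 (fun p => (g i p : ℂ)) ξ‖ ^ 2 := by
      intro ξ
      rw [fourier_eq_mul_fourier hu (hg i) i (h i hi) ξ, norm_mul, norm_mul, Complex.norm_I,
        Complex.norm_real, mul_one, mul_pow, Real.norm_eq_abs, sq_abs]
      ring
    simp only [e]
    have hi1 : Integrable fun p => (g i p : ℂ) := (hg i).integrable.ofReal
    have hi2 : MemLp (fun p => (g i p : ℂ)) 2 := (hg i).memLp.ofReal
    have hF := memLp_fourier hi1 hi2
    refine ⟨(memLp_two_iff_integrable_sq_norm hF.1).1 hF, ?_⟩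
    rw [plancherel hi1 hi2]
    simp
  obtain ⟨i0, e0⟩ := hp 0 (by decide)
  obtain ⟨i1, e1⟩ := hp 1 (by decide)
  have hsplit : ∀ ξ : E3, 4 * Real.pi ^ 2 * (‖planar ξ‖ ^ 2 * ‖𝓕 (fun p => (u p : ℂ)) ξ‖ ^ 2)
      = 4 * Real.pi ^ 2 * (ξ 0 ^ 2 * ‖𝓕 (fun p => (u p : ℂ)) ξ‖ ^ 2)
        + 4 * Real.pi ^ 2 * (ξ 1 ^ 2 * ‖𝓕 (fun p => (u p : ℂ)) ξ‖ ^ 2) := by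
    intro ξ
    rw [EuclideanSpace.norm_sq_eq]
    simp only [Fin.sum_univ_two, planar, Real.norm_eq_abs, sq_abs]
    simp only [Matrix.cons_val_zero, Matrix.cons_val_one]
    ring
  constructor
  · have := (i0.add i1).const_mul (4 * Real.pi ^ 2)⁻¹
    refine this.congr (Eventually.of_forall fun ξ => ?_)
    simp only [Pi.add_apply]
    rw [← hsplit ξ, inv_mul_cancel_left₀ hpi]
  · rw [← integral_const_mul, ← e0, ← e1, ← integral_add i0 i1]
    exact integral_congr_ae (Eventually.of_forall hsplit)

/-- The dipolar energy in Fourier space. The vertical derivative of `u` is the charge `f` in the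
film, together with surface charges on its bottom and top, where `u` may jump. -/
theorem hasDipolarEnergy_of_slab (hδ : 0 < δ) (hu : IsSlabFunction δ R u)
    (hf : IsSlabFunction δ R f)
    (hparts : ∀ ζ : E3 → ℝ, ContDiff ℝ (⊤ : ℕ∞) ζ →
      (∀ r, ζ (atHeight r 0) = 0 ∧ ζ (atHeight r δ) = 0) →
      ∫ p, u p * partialDeriv 2 ζ p = - ∫ p, f p * ζ p) :
    HasDipolarEnergy u (∫ ξ : E3, ‖𝓕 (fun p => (u p : ℂ)) ξ‖ ^ 2 * (ξ 2 ^ 2 / ‖ξ‖ ^ 2)) := by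
  set a : E3 → ℝ := fun p => δ⁻¹ * (u p - (δ - p 2) * f p) with ha_def
  set b : E3 → ℝ := fun p => -(δ⁻¹ * (u p + p 2 * f p)) with hb_def
  have hc2 : Continuous fun p : E3 => p 2 := by fun_prop
  have ha : IsSlabFunction δ R a := by
    have h1 := (hu.add (hf.continuous_mul (ζ := fun p => δ - p 2) (by fun_prop)).neg).continuous_mul
      (ζ := fun _ => δ⁻¹) continuous_const
    simpa only [Pi.add_apply, Pi.neg_apply, ← sub_eq_add_neg] using h1
  have hb : IsSlabFunction δ R b :=
    ((hu.add (hf.continuous_mul hc2)).continuous_mul (ζ := fun _ => δ⁻¹) continuous_const).neg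
  set μ := chargeMeasure δ f a b with hμ
  set ν := chargeMeasure δ (-f) (-a) (-b) with hν
  have hμf : IsFiniteMeasure μ := isFiniteMeasure_chargeMeasure hf ha hb
  have hνf : IsFiniteMeasure ν := isFiniteMeasure_chargeMeasure hf.neg ha.neg hb.neg
  have hderiv : ∀ ζ : E3 → ℝ, ContDiff ℝ (⊤ : ℕ∞) ζ →
      ∫ p, u p * partialDeriv 2 ζ p = - (∫ p, ζ p ∂μ - ∫ p, ζ p ∂ν) := by
    intro ζ hζ
    rw [integral_chargeMeasure_sub hf ha hb hζ.continuous,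
      integral_mul_partialDeriv_two hδ hu hf hparts hζ]
    rfl
  have hfin : newtonEnergy (μ + ν) (μ + ν) ≠ ∞ := by
    have hm : MemLp (fun p => ‖f p‖ + ‖a p‖ + ‖b p‖) 2 :=
      (hf.memLp.norm.add ha.memLp.norm).add hb.memLp.norm
    have hsm : AEMeasurable fun p => ‖f p‖ₑ + ‖a p‖ₑ + ‖b p‖ₑ :=
      (hf.memLp.1.enorm.add ha.memLp.1.enorm).add hb.memLp.1.enorm
    refine newtonEnergy_ne_top (R := R) (δ := δ) hsm ?_ (fun p hp => ?_)
      fun k hk => lintegral_chargeMeasure_planar hf ha hb hk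
    · have h2 := hm.2
      rw [eLpNorm_lt_top_iff_lintegral_rpow_enorm_lt_top (by norm_num) (by norm_num)] at h2
      refine ne_of_lt (lt_of_le_of_lt (le_of_eq ?_) h2)
      refine lintegral_congr fun p => ?_
      have e : ‖(‖f p‖ + ‖a p‖ + ‖b p‖)‖ₑ = ‖f p‖ₑ + ‖a p‖ₑ + ‖b p‖ₑ := by
        rw [Real.enorm_of_nonneg (by positivity),
          ENNReal.ofReal_add (add_nonneg (norm_nonneg (f p)) (norm_nonneg (a p)))
            (norm_nonneg (b p)),
          ENNReal.ofReal_add (norm_nonneg (f p)) (norm_nonneg (a p)), ofReal_norm, ofReal_norm,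
          ofReal_norm]
      rw [ENNReal.toReal_ofNat, e, ENNReal.rpow_ofNat]
    · rw [hf.eq_zero p hp, ha.eq_zero p hp, hb.eq_zero p hp]
      simp
  refine ⟨μ, ν, ⟨hu.integrable.locallyIntegrable, hμf, hνf, fun ζ hζ => hderiv ζ hζ.1⟩, hfin, ?_⟩
  rw [signed_newtonEnergy_eq_fourier hfin]
  refine integral_congr_ae (Eventually.of_forall fun ξ => ?_)
  simp only
  rw [measureFourier_sub_eq hu 2 hderiv ξ, norm_mul, norm_mul, Complex.norm_I, Complex.norm_real,
    mul_one, mul_pow, Real.norm_eq_abs, sq_abs]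
  have hpi := Real.pi_pos.ne'
  rcases eq_or_ne (‖ξ‖ ^ 2) 0 with h0 | h0
  -- At `ξ = 0` both quotients are `0` by convention.
  · simp [h0]
  · field_simp
    ring

variable {η : ℝ → ℝ} {D : Set E2} {Ω : Set E3} {φ : E3 → ℝ}

lemma isSlabFunction_indicator (hΩ : IsFilm δ D Ω) (hR : Ω ⊆ slabSet δ R)
    (hφ : MemLp φ 2 (volume.restrict Ω)) : IsSlabFunction δ R (Ω.indicator φ) :=
  ⟨(memLp_indicator_iff_restrict hΩ.isOpen_film.measurableSet).2 hφ,
    fun _ hp => Set.indicator_of_notMem (fun h => hp (hR h)) _⟩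

lemma cutField_eq_zero {p : E3} (hp : p ∉ Ω) : cutField η δ D Ω φ p = 0 := by
  simp [cutField, hp]

/-- Inside the film the average may be taken over the whole vertical line. -/
lemma cutAverage_eq (hη : IsCutoffProfile η) (hδ : 0 < δ) (hΩ : IsFilm δ D Ω) (φ : E3 → ℝ) :
    cutAverage η δ D φ = fun r => δ⁻¹ * ∫ z, cutField η δ D Ω φ (atHeight r z) := by
  ext r
  by_cases hr : r ∈ D
  · have h : ∀ z, cutField η δ D Ω φ (atHeight r z)
        = cutoff η δ D r * (Set.Ioo 0 δ).indicator (fun z => φ (atHeight r z)) z := by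
      intro z
      rw [cutField, planar_atHeight]
      congr 1
      by_cases hz : z ∈ Set.Ioo 0 δ
      · have : atHeight r z ∈ Ω := hΩ.subset_film
          ⟨by rwa [planar_atHeight], by rwa [atHeight_two]⟩
        rw [Set.indicator_of_mem hz, Set.indicator_of_mem this]
      · have : atHeight r z ∉ Ω := fun hm => hz (by
          have := (hΩ.film_subset hm).2
          rwa [atHeight_two] at this)
        rw [Set.indicator_of_notMem hz, Set.indicator_of_notMem this]
    simp only [h]
    rw [integral_const_mul, integral_indicator measurableSet_Ioo, cutAverage, zAverage,
      Set.indicator_of_mem hr, intervalIntegral.integral_of_le hδ.le, integral_Ioc_eq_integral_Ioo]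
    ring
  · have h := cutoff_eq_zero_of_notMem hη hδ hr
    simp [cutAverage, cutField, planar_atHeight, h]

end Assembly

end ThinFilm

/-- The dipolar energy `E` of `χ_δ φ`, the half-Laplacian `g` of `χ_δ φ̄` and the weak gradient
`G` of `χ_δ φ` exist, are each determined by the function they belong to (`g` and `G` almost
everywhere), and satisfy the estimate. -/
theorem lemmal (δ : ℝ) (hδ : 0 < δ) (η : ℝ → ℝ) (hη : IsCutoffProfile η)
    (D : Set E2) (Ω : Set E3) (hΩ : IsFilm δ D Ω) (φ : E3 → ℝ) (hφ : MemH1 Ω φ) :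
    ∃ (E : ℝ) (g : E2 → ℝ) (G : E3 → E3),
      HasDipolarEnergy (cutField η δ D Ω φ) E ∧
      IsHalfLaplacian (cutAverage η δ D φ) g ∧
      IsWeakGradient Ω (cutField η δ D Ω φ) G ∧
      MemLp G 2 (volume.restrict Ω) ∧
      |E - (∫ p : E3, cutoff η δ D (planar p) ^ 2 * Ω.indicator φ p ^ 2)
          + δ ^ 2 / 2 * ∫ r : E2, cutAverage η δ D φ r * g r|
        ≤ δ ^ 2 / 2 * ∫ p in Ω, ‖G p‖ ^ 2 := by
  obtain ⟨hφ2, G₀, hw, hG₀⟩ := hφ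
  obtain ⟨R, hR⟩ := hΩ.exists_radius
  have hΩm := hΩ.isOpen_film.measurableSet
  have hcu := (continuous_cutoff hη δ D).comp continuous_planar
  set u := cutField η δ D Ω φ with hu_def
  set G := cutGrad η δ D φ G₀ with hG_def
  have hG : MemLp G 2 (volume.restrict Ω) := memLp_cutGrad hη hφ2 hG₀
  have hGi : ∀ i, MemLp (fun p => G p i) 2 (volume.restrict Ω) := fun i =>
    hG.continuousLinearMap_comp (EuclideanSpace.proj (𝕜 := ℝ) i)
  have hu : IsSlabFunction δ R u := (isSlabFunction_indicator hΩ hR hφ2).continuous_mul hcu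
  set g : Fin 3 → E3 → ℝ := fun i => Ω.indicator fun p => G p i with hg_def
  have hg : ∀ i, IsSlabFunction δ R (g i) := fun i => isSlabFunction_indicator hΩ hR (hGi i)
  have hparts : ∀ (i : Fin 3) (ζ : E3 → ℝ), ContDiff ℝ (⊤ : ℕ∞) ζ →
      (i = 2 → ∀ r, ζ (atHeight r 0) = 0 ∧ ζ (atHeight r δ) = 0) →
      ∫ p, u p * partialDeriv i ζ p = - ∫ p, g i p * ζ p := by
    intro i ζ hζ hi
    have key := integral_cutField_mul_partialDeriv hδ hη hΩ hφ2 hG₀ hw hζ i hi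
    rw [setIntegral_eq_integral_of_forall_compl_eq_zero
      fun p hp => by rw [cutField_eq_zero hp, zero_mul]] at key
    rw [key, ← integral_indicator hΩm]
    simp only [hg_def, ← Set.indicator_mul_left]
    rfl
  obtain ⟨hQ, hQe⟩ := integral_planar_sq_mul_fourier hu hg
    fun i hi ζ hζ => hparts i ζ hζ fun h => absurd h hi
  obtain ⟨hhalf, hest⟩ := film_fourier_estimate hδ hu hQ
  have hav : cutAverage η δ D φ = fun r => δ⁻¹ * ∫ z, u (atHeight r z) :=
    cutAverage_eq hη hδ hΩ φ
  obtain ⟨h, hh, hhe⟩ := exists_halfLaplacian (integrable_average hu) (memLp_average hδ hu) hhalf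
  rw [← hav] at hh
  refine ⟨_, h, G, hasDipolarEnergy_of_slab hδ hu (hg 2) fun ζ hζ hv => hparts 2 ζ hζ fun _ => hv,
    hh, ⟨hu.integrable.locallyIntegrable.locallyIntegrableOn Ω, ?_, ?_⟩, hG, ?_⟩
  · have : IsFiniteMeasure (volume.restrict Ω) := ⟨by simpa using hΩ.volume_lt_top⟩
    exact IntegrableOn.locallyIntegrableOn (hG.integrable (by norm_num))
  · intro ζ hζ i
    refine integral_cutField_mul_partialDeriv hδ hη hΩ hφ2 hG₀ hw hζ.1 i fun _ r => ?_
    -- The film lies strictly between the planes `z = 0` and `z = δ`.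
    have hz : ∀ c, c ∉ Set.Ioo 0 δ → ζ (atHeight r c) = 0 := by
      intro c hc
      refine image_eq_zero_of_notMem_tsupport fun hm => hc ?_
      have := (hΩ.film_subset (hζ.2.2 hm)).2
      rwa [atHeight_two] at this
    exact ⟨hz 0 (by simp), hz δ (by simp)⟩
  · have e1 : ∫ p : E3, cutoff η δ D (planar p) ^ 2 * Ω.indicator φ p ^ 2 = ∫ p, u p ^ 2 := by
      refine integral_congr_ae (Filter.Eventually.of_forall fun p => ?_)
      simp only [hu_def, cutField, mul_pow]
    have hsq : ∀ i, ∫ p, g i p ^ 2 = ∫ p in Ω, G p i ^ 2 := by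
      intro i
      rw [← integral_indicator hΩm]
      refine integral_congr_ae (Filter.Eventually.of_forall fun p => ?_)
      by_cases hp : p ∈ Ω <;> simp [hg_def, hp]
    have hint : ∀ i, Integrable (fun p => G p i ^ 2) (volume.restrict Ω) := fun i =>
      (hGi i).integrable_sq
    have hle : (∫ p, g 0 p ^ 2) + ∫ p, g 1 p ^ 2 ≤ ∫ p in Ω, ‖G p‖ ^ 2 := by
      rw [hsq, hsq, ← integral_add (hint 0) (hint 1)]
      refine integral_mono ((hint 0).add (hint 1))
        ((memLp_two_iff_integrable_sq_norm hG.1).1 hG) fun p => ?_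
      simp only [EuclideanSpace.norm_sq_eq, Fin.sum_univ_three, Real.norm_eq_abs, sq_abs]
      exact le_add_of_nonneg_right (sq_nonneg _)
    rw [e1, hav, hhe]
    refine hest.trans ?_
    rw [hQe]
    gcongr
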